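/- Let $R$ be a finite dimensional unital associative complex algebra, and let $e_1,\dots,e_m$ be a complete set of primitive orthogonal idempotents of $R$ (so $1=e_1+\cdots+e_m$, $e_i^2=e_i$, $e_ie_j=0$ for $i\ne j$, and no $e_i$ is a sum of two nonzero orthogonal idempotents). Let $\mathcal M(R)$ be the ring of $R$-valued meromorphic functions on $\mathbb C$, a right $R$-module, let $\mathcal D(R)$ be the algebra of differential operators $\sum_k a_k(x)\partial_x^k$ whose coefficients $a_k$ are $R$-valued rational functions, acting on $\mathcal M(R)$ (with $a_k$ acting by left multiplication), and for $P\in\mathcal D(R)$ let $\ker P=\{f\in\mathcal M(R): Pf=0\}$. Let $$\mathcal{QP}(R)=\bigoplus_{\alpha\in\mathbb C}R[x]\exp(\alpha x)\subset\mathcal M(R)$$ be the right $R$-module of $R$-valued quasipolynomials. Let $\mathcal P$ be the set of monic operators $P\in\mathcal D(R)$ for which there are a monic operator $L\in R[\partial_x]$ with constant coefficients and some $Q\in\mathcal D(R)$ with $L=QP$. The decorated adelic Grassmannian $\widetilde{\mathrm{Gr}}^{\mathrm{Ad}}(R)$ is the set of all functions $P(x,\partial_x)\exp(xz)$ with $P\in\mathcal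 P$. A free right $R$-submodule $V\subset\mathcal{QP}(R)$ of finite rank $l$ is called nondegenerate if it has a basis $F_1,\dots,F_l$ whose Wronski matrix $(\partial_x^{i-1}F_j)_{i,j=1}^l$ is invertible in $M_l(\mathcal M(R))$. Let $\mathcal V$ be the set of all finite rank free right $R$-submodules $V\subset\mathcal{QP}(R)$ that are nondegenerate and satisfy (a) $V$ has an $R$-basis consisting of elements of the form $p_1(x)\exp(\alpha_1x)e_1+\cdots+p_m(x)\exp(\alpha_mx)e_m$ with $p_k\in R[x]$, $\alpha_k\in\mathbb C$ (the $p_k$ and $\alpha_k$ may vary with the basis element). Then the following hold. 1. The map $P\mapsto P(x,\partial_x)\exp(xz)$ is a bijection from $\mathcal P$ onto $\widetilde{\mathrm{Gr}}^{\mathrm{Ad}}(R)$, and the map $P\mapsto\ker P$ is a bijection from $\mathcal P$ onto $\mathcal V$. Hence the points of $\widetilde{\mathrm{Gr}}^{\mathrm{Ad}}(R)$ are in bijection with $\mathcal V$. 2. If $V\in\mathcal V$ has rank $l$, the operator $P\in\mathcal P$ corresponding to $V$ has order $l$, and it is the unique monic operator of order $l$ in $\mathcal D(R)$ with kernel $V$.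 3. Every $V\in\mathcal V$ is a direct summand of the right $R$-module $\mathcal{QP}(R)$. 4. For every finite rank free right $R$-submodule $V\subset\mathcal{QP}(R)$ (nondegenerate or not), condition (a) is equivalent to each of the following: (b) $V=\bigoplus_{k=1}^np_k(x)\exp(\alpha_kx)e_{i_k}R$ for some $n\ge 0$, $p_k\in R[x]$, $\alpha_k\in\mathbb C$ and $1\le i_k\le m$ (repetitions allowed); (c) $V=\bigoplus_{\alpha\in\mathbb C}\bigl(V\cap R[x]\exp(\alpha x)\bigr)$. -/

import Mathlib

open scoped TensorProduct Polynomial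

noncomputable section

/-! ### Scalar meromorphic functions on the complex plane -/

/-- The algebra of honest functions `ℂ → ℂ` that are meromorphic at every point. -/
def MeroFun : Subalgebra ℂ (ℂ → ℂ) where
  carrier := {f | Meromorphic f}
  mul_mem' hf hg := Meromorphic.mul hf hg
  add_mem' hf hg := Meromorphic.add hf hg
  algebraMap_mem' c := Meromorphic.const c

theorem mem_MeroFun {f : ℂ → ℂ} : f ∈ MeroFun ↔ Meromorphic f := Iff.rfl

/-- The meromorphic functions that vanish off a closed discrete set; they represent `0`. -/
def MeroNull : Ideal MeroFun where
  carrier := {f | (f : ℂ → ℂ) =ᶠ[Filter.codiscrete ℂ] 0}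
  zero_mem' := by
    change ((0 : ℂ → ℂ)) =ᶠ[Filter.codiscrete ℂ] 0
    exact Filter.EventuallyEq.refl _ _
  add_mem' {f g} hf hg := by
    change (f : ℂ → ℂ) =ᶠ[Filter.codiscrete ℂ] 0 at hf
    change (g : ℂ → ℂ) =ᶠ[Filter.codiscrete ℂ] 0 at hg
    change ((f : ℂ → ℂ) + (g : ℂ → ℂ)) =ᶠ[Filter.codiscrete ℂ] 0
    filter_upwards [hf, hg] with x hx hy
    simp [hx, hy]
  smul_mem' c f hf := by
    change (f : ℂ → ℂ) =ᶠ[Filter.codiscrete ℂ] 0 at hf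
    change ((c : ℂ → ℂ) * (f : ℂ → ℂ)) =ᶠ[Filter.codiscrete ℂ] 0
    filter_upwards [hf] with x hx
    simp [hx]

/-- Meromorphic functions on `ℂ`: two functions that agree off a closed discrete set are
identified, so that the arbitrary values at the poles play no role. -/
def Mero : Type := MeroFun ⧸ MeroNull

instance : CommRing Mero := inferInstanceAs (CommRing (MeroFun ⧸ MeroNull))

instance : Algebra ℂ Mero := inferInstanceAs (Algebra ℂ (MeroFun ⧸ MeroNull))

/-- The class of a meromorphic function. -/
def Mero.of (f : ℂ → ℂ) (hf : Meromorphic f) : Mero := Ideal.Quotient.mk MeroNull ⟨f, mem_MeroFun.2 hf⟩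

theorem Mero.of_eq {f g : ℂ → ℂ} {hf : Meromorphic f} {hg : Meromorphic g} :
    Mero.of f hf = Mero.of g hg ↔ f =ᶠ[Filter.codiscrete ℂ] g := by
  refine Iff.trans (Ideal.Quotient.eq (I := MeroNull)) ?_
  change (f - g) =ᶠ[Filter.codiscrete ℂ] 0 ↔ _
  constructor
  · intro h
    filter_upwards [h] with x hx
    simpa [sub_eq_zero] using hx
  · intro h
    filter_upwards [h] with x hx
    simp [hx]

theorem Mero.analytic_codiscrete {f : ℂ → ℂ} (hf : Meromorphic f) :
    ∀ᶠ x in Filter.codiscrete ℂ, AnalyticAt ℂ f x :=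
  MeromorphicOn.eventually_codiscreteWithin_analyticAt f (U := Set.univ) (fun x _ => hf x)

/-- The derivative `d/dx` on meromorphic functions. -/
def Mero.D : Mero →ₗ[ℂ] Mero where
  toFun := Quotient.lift (s := Submodule.quotientRel MeroNull)
    (fun f : MeroFun => Mero.of (deriv (f : ℂ → ℂ)) (Meromorphic.deriv f.2)) (by
      intro f g h
      have h' : Mero.of f f.2 = Mero.of g g.2 := Quotient.sound h
      refine Mero.of_eq.2 ?_
      replace h' := Mero.of_eq.1 h'
      exact MeromorphicOn.deriv_eventuallyEq_codiscreteWithin (U := Set.univ)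
        (fun x _ => f.2 x) (fun x _ => g.2 x) h')
  map_add' a b := by
    induction a using Quotient.inductionOn with | _ f =>
    induction b using Quotient.inductionOn with | _ g =>
    change Mero.of (deriv ((f : ℂ → ℂ) + g)) _
      = Mero.of (deriv (f : ℂ → ℂ) + deriv (g : ℂ → ℂ)) ((Meromorphic.deriv f.2).add (Meromorphic.deriv g.2))
    refine Mero.of_eq.2 ?_
    filter_upwards [Mero.analytic_codiscrete f.2, Mero.analytic_codiscrete g.2] with x hx hy
    exact deriv_add hx.differentiableAt hy.differentiableAt
  map_smul' c a := by
    induction a using Quotient.inductionOn with | _ f =>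
    change Mero.of (deriv (c • (f : ℂ → ℂ))) _
      = Mero.of (c • deriv (f : ℂ → ℂ)) ((Meromorphic.deriv f.2).const_smul c)
    refine Mero.of_eq.2 ?_
    filter_upwards [Mero.analytic_codiscrete f.2] with x hx
    exact deriv_const_smul c hx.differentiableAt

/-- The coordinate function `x`. -/
def Mero.X : Mero := Mero.of (fun x => x) (fun x => AnalyticAt.meromorphicAt (by fun_prop))

/-- The exponential `exp (α x)`. -/
def Mero.exp (α : ℂ) : Mero :=
  Mero.of (fun x => Complex.exp (α * x)) (fun x => AnalyticAt.meromorphicAt (by fun_prop))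

/-! ### Meromorphic functions with values in a finite dimensional algebra -/

section RValued

variable (R : Type*) [Ring R] [Algebra ℂ R]

/-- `R`-valued meromorphic functions on `ℂ`, for `R` finite dimensional: finite sums of
`r f(x)` with `r ∈ R` and `f` scalar meromorphic, i.e. the ring `R ⊗ Mero`. -/
abbrev RMero : Type _ := R ⊗[ℂ] Mero

/-- The derivative `∂_x` on `R`-valued meromorphic functions, a homomorphism of right
`R`-modules. -/
def RMero.D : Module.End Rᵐᵒᵖ (RMero R) :=
  TensorProduct.AlgebraTensorModule.map (LinearMap.id : R →ₗ[Rᵐᵒᵖ] R) Mero.D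

variable {R}

theorem RMero.mul_op_smul (a f : RMero R) (s : Rᵐᵒᵖ) : a * (s • f) = s • (a * f) := by
  induction f using TensorProduct.induction_on with
  | zero => simp
  | add f g hf hg => simp only [smul_add, mul_add, hf, hg]
  | tmul r u =>
    induction a using TensorProduct.induction_on with
    | zero => simp
    | add a b ha hb => simp only [add_mul, smul_add, ha, hb]
    | tmul t v =>
      simp [TensorProduct.smul_tmul', Algebra.TensorProduct.tmul_mul_tmul, MulOpposite.smul_eq_mul_unop,
        mul_assoc]

/-- The differential operator of order zero `f ↦ a f`. -/
def RMero.mulLeft (a : RMero R) : Module.End Rᵐᵒᵖ (RMero R) where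
  toFun f := a * f
  map_add' f g := mul_add a f g
  map_smul' s f := RMero.mul_op_smul a f s

/-- The constant function with value `r`. -/
def RMero.const (r : R) : RMero R := r ⊗ₜ 1

/-- The quasipolynomial `p(x) exp (α x)`, for `p ∈ R[x]`. -/
def quasiPoly (p : R[X]) (α : ℂ) : RMero R :=
  p.sum fun k r => r ⊗ₜ[ℂ] (Mero.X ^ k * Mero.exp α)

/-- An `R`-valued polynomial as a meromorphic function. -/
def RMero.ofPoly (p : R[X]) : RMero R := p.sum fun k r => r ⊗ₜ[ℂ] (Mero.X ^ k)

/-- `f` is rational: `q(x) f(x) = p(x)` with `p ∈ R[x]` and `0 ≠ q ∈ ℂ[x]`. -/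
def RMero.IsRational (f : RMero R) : Prop :=
  ∃ (p : R[X]) (q : ℂ[X]), q ≠ 0 ∧
    ((1 : R) ⊗ₜ[ℂ] (Polynomial.aeval Mero.X q : Mero)) * f = RMero.ofPoly p

/-- `f` is a constant function. -/
def RMero.IsConst (f : RMero R) : Prop := ∃ r : R, f = RMero.const r

/-- The operator `∑_{k < n} a_k(x) ∂_x^k`. -/
def diffOp {n : ℕ} (a : Fin n → RMero R) : Module.End Rᵐᵒᵖ (RMero R) :=
  ∑ k : Fin n, RMero.mulLeft (a k) * RMero.D R ^ (k : ℕ)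

/-- Membership in the algebra of `R`-valued differential operators with rational coefficients;
its multiplication is composition of operators. -/
def IsRationalOp (T : Module.End Rᵐᵒᵖ (RMero R)) : Prop :=
  ∃ (n : ℕ) (a : Fin n → RMero R), (∀ k, (a k).IsRational) ∧ T = diffOp a

/-- Monic operators `∂_x^n + ∑_{k < n} a_k(x) ∂_x^k` of order `n` with rational coefficients. -/
def IsMonicRationalOp (n : ℕ) (P : Module.End Rᵐᵒᵖ (RMero R)) : Prop :=
  ∃ a : Fin n → RMero R, (∀ k, (a k).IsRational) ∧ P = RMero.D R ^ n + diffOp a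

/-- Monic operators of order `n` with constant coefficients. -/
def IsMonicConstOp (n : ℕ) (L : Module.End Rᵐᵒᵖ (RMero R)) : Prop :=
  ∃ a : Fin n → RMero R, (∀ k, (a k).IsConst) ∧ L = RMero.D R ^ n + diffOp a

variable (R)

/-- The monic operators with rational coefficients which right-divide, in the algebra of
operators with rational coefficients, a monic operator with constant coefficients. -/
def darbouxOps : Set (Module.End Rᵐᵒᵖ (RMero R)) :=
  {P | (∃ n, IsMonicRationalOp n P) ∧
    ∃ (N : ℕ) (L Q : Module.End Rᵐᵒᵖ (RMero R)),
      IsMonicConstOp N L ∧ IsRationalOp Q ∧ L = Q * P}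

variable {R}

/-- The function `P(x, ∂_x) exp (x z)` of two variables, as the map sending `z` to a
meromorphic function of `x` (its dependence on `z` is entire). -/
def waveFun (P : Module.End Rᵐᵒᵖ (RMero R)) : ℂ → RMero R :=
  fun z => P ((1 : R) ⊗ₜ Mero.exp z)

variable (R)

/-- The decorated adelic Grassmannian: the set of functions `P(x, ∂_x) exp (x z)`. -/
def decoratedGr : Set (ℂ → RMero R) :=
  {Φ | ∃ P ∈ darbouxOps R, Φ = waveFun P}

/-- The right `R`-module `R[x] exp (α x)`. -/
def expComponent (α : ℂ) : Submodule Rᵐᵒᵖ (RMero R) where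
  carrier := {f | ∃ p : R[X], f = quasiPoly p α}
  zero_mem' := ⟨0, by simp [quasiPoly]⟩
  add_mem' := by
    rintro _ _ ⟨p, rfl⟩ ⟨q, rfl⟩
    refine ⟨p + q, ?_⟩
    unfold quasiPoly
    rw [Polynomial.sum_add_index] <;> simp [TensorProduct.add_tmul]
  smul_mem' := by
    rintro s _ ⟨p, rfl⟩
    refine ⟨p * Polynomial.C s.unop, ?_⟩
    unfold quasiPoly
    rw [Polynomial.sum_eq_of_subset (p := p * Polynomial.C s.unop) (s := p.support) _ (by simp)
      (fun k hk => by
        rw [Polynomial.mem_support_iff] at hk ⊢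
        intro h0
        exact hk (by simp [h0])), Polynomial.sum_def, Finset.smul_sum]
    refine Finset.sum_congr rfl fun k _ => ?_
    simp [TensorProduct.smul_tmul', MulOpposite.smul_eq_mul_unop]

/-- The right `R`-module of `R`-valued quasipolynomials, the sum of all `R[x] exp (α x)`. -/
def quasiPolys : Submodule Rᵐᵒᵖ (RMero R) := ⨆ α : ℂ, expComponent R α

variable {R}

/-- The Wronski matrix, with rows `∂^i F_1, …, ∂^i F_l` for `i = 0, …, l - 1`. -/
def wronskiMatrix {l : ℕ} (F : Fin l → RMero R) : Matrix (Fin l) (Fin l) (RMero R) :=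
  Matrix.of fun i j => (RMero.D R ^ (i : ℕ)) (F j)

/-- `V` is a free right `R`-module of rank `l`. -/
def IsFreeOfRank (V : Submodule Rᵐᵒᵖ (RMero R)) (l : ℕ) : Prop :=
  Nonempty (Module.Basis (Fin l) Rᵐᵒᵖ V)

/-- `V` is free of finite rank, and the Wronski matrix of one of its bases is invertible as a
matrix with meromorphic entries. -/
def IsNondegenerate (V : Submodule Rᵐᵒᵖ (RMero R)) : Prop :=
  ∃ (l : ℕ) (b : Module.Basis (Fin l) Rᵐᵒᵖ V),
    IsUnit (wronskiMatrix fun j => (b j : RMero R))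

/-- A complete set of primitive orthogonal idempotents: no `e_i` is the sum of two nonzero
orthogonal idempotents. -/
structure IsPrimitiveSystem {m : ℕ} (e : Fin m → R) : Prop where
  complete : CompleteOrthogonalIdempotents e
  primitive : ∀ i, ∀ f g : R, IsIdempotentElem f → IsIdempotentElem g → f * g = 0 → g * f = 0 →
    e i = f + g → f = 0 ∨ g = 0

/-- The first adelic type condition: a basis of elements `∑_k p_k(x) exp (α_k x) e_k`. -/
def HasAdelicBasis {m : ℕ} (e : Fin m → R) (V : Submodule Rᵐᵒᵖ (RMero R)) : Prop :=
  ∃ (l : ℕ) (b : Module.Basis (Fin l) Rᵐᵒᵖ V) (p : Fin l → Fin m → R[X]) (α : Fin l → Fin m → ℂ),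
    ∀ j, (b j : RMero R) = ∑ k, MulOpposite.op (e k) • quasiPoly (p j k) (α j k)

/-- The second adelic type condition: an internal direct sum
`V = ⨁_k p_k(x) exp (α_k x) e_{i_k} R`. -/
def HasCyclicDecomposition {m : ℕ} (e : Fin m → R) (V : Submodule Rᵐᵒᵖ (RMero R)) : Prop :=
  ∃ (n : ℕ) (p : Fin n → R[X]) (α : Fin n → ℂ) (i : Fin n → Fin m),
    iSupIndep (fun k => Submodule.span Rᵐᵒᵖ {MulOpposite.op (e (i k)) • quasiPoly (p k) (α k)}) ∧
    V = ⨆ k, Submodule.span Rᵐᵒᵖ {MulOpposite.op (e (i k)) • quasiPoly (p k) (α k)}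

/-- The third adelic type condition: the internal direct sum
`V = ⨁_α (V ∩ R[x] exp (α x))`. -/
def IsGradedByExponents (V : Submodule Rᵐᵒᵖ (RMero R)) : Prop :=
  iSupIndep (fun α : ℂ => V ⊓ expComponent R α) ∧ V = ⨆ α : ℂ, V ⊓ expComponent R α

/-- The finite rank free nondegenerate right submodules of the quasipolynomials that are of
adelic type. -/
def adelicModules {m : ℕ} (e : Fin m → R) : Set (Submodule Rᵐᵒᵖ (RMero R)) :=
  {V | V ≤ quasiPolys R ∧ IsNondegenerate V ∧ HasAdelicBasis e V}

end RValued

end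

/-!
# Right divisors of constant coefficient operators over a finite dimensional algebra

Let `d = dim R`. The scalar meromorphic functions form a differential field `Mero` with constants
`ℂ`, and `RMero R = R ⊗ Mero` is a differential module over it.

*From operators to modules.* Let `P` be monic of order `n` and let it right-divide a monic operator
with constant coefficients in `R`. Since the remainders of the powers of `∂` modulo that operator
lie in a finite dimensional space, `P` right-divides even `χ(∂)` for a monic `χ ∈ ℂ[X]`
(`mem_darbouxOps_iff`). The kernel of `χ(∂)` consists of quasipolynomials and has dimension
`d · deg χ` (`isFullOp_aeval_D`), because `∂ - α` is surjective on quasipolynomials. On the other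
hand a monic operator of order `n` has at most `n d` independent solutions, because their jets are
independent over `Mero` (`linearIndependent_jet`). Applied to both factors of `χ(∂) = Q P` this
gives `dim ker P = n d` (`finrank_ker`). The determinant formed from the jets of a basis of `ker P`
is then a nonzero entire function; at a point where it does not vanish, the jet is an isomorphism of
right modules `ker P → R^n` (`exists_jet_bijective`). Hence `ker P` is free of rank `n` and
nondegenerate, and the quasipolynomials whose jet vanishes at that point form a complement of it.
Clearing denominators, `P` preserves each `R[x] exp (α x)`, so `ker P` is graded by the exponents
(`isGradedByExponents_ker`).

*The three conditions.* The step from the grading to a basis of adelic type is an exchange argument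
in the style of Krull, Schmidt and Azumaya (`exists_basis_op_smul_mem`). For an arbitrary basis
`b_j`, the piece `b_j e_k` is a sum of homogeneous elements `w_α`, and the coordinates of the
`w_α e_k` at `b_j` add up to `e_k`. As `e_k R e_k` is local, some `w_α e_k` can replace `b_j e_k`, and
one treats all pairs `(j, k)` in turn.

*From modules to operators.* A basis `F` of adelic type of a nondegenerate `V` has an invertible
Wronski matrix `W`, and `∂^l - (∂^l F) W⁻¹ (1, ∂, …, ∂^(l-1))ᵀ` kills `F`. The exponential factors
of the columns cancel, so the coefficients are rational
(`exists_isMonicRationalOp_of_isUnit_wronskiMatrix`). Some monic `χ(∂)` kills `F` as well, and its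
remainder modulo this operator is zero because `W` is invertible; a comparison of dimensions shows
that the kernel is `V`.
-/

open scoped Matrix

noncomputable section

/-! ### The differential field of meromorphic functions -/

namespace Mero

theorem exists_of (a : Mero) : ∃ (f : ℂ → ℂ) (hf : Meromorphic f), a = of f hf := by
  induction a using Quotient.inductionOn with | _ f => exact ⟨f, f.2, rfl⟩

theorem of_mul {f g : ℂ → ℂ} (hf : Meromorphic f) (hg : Meromorphic g) :
    of f hf * of g hg = of (f * g) (hf.mul hg) := rfl

theorem of_add {f g : ℂ → ℂ} (hf : Meromorphic f) (hg : Meromorphic g) :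
    of f hf + of g hg = of (f + g) (hf.add hg) := rfl

theorem of_one : of (fun _ => 1) (Meromorphic.const 1) = 1 := rfl

theorem of_zero : of (fun _ => 0) (Meromorphic.const 0) = 0 := rfl

theorem algebraMap_eq_of (c : ℂ) : algebraMap ℂ Mero c = of (fun _ => c) (Meromorphic.const c) := rfl

theorem D_of {f : ℂ → ℂ} (hf : Meromorphic f) : D (of f hf) = of (deriv f) hf.deriv := rfl

theorem of_congr {f g : ℂ → ℂ} {hf : Meromorphic f} {hg : Meromorphic g} (h : ∀ x, f x = g x) :
    of f hf = of g hg :=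
  of_eq.2 (Filter.Eventually.of_forall h)

theorem dense_of_mem_codiscrete {s : Set ℂ} (hs : s ∈ Filter.codiscrete ℂ) : Dense s := by
  intro x
  have h := mem_codiscrete.1 hs x
  rw [Filter.disjoint_principal_right, compl_compl] at h
  exact mem_closure_iff_frequently.2
    ((Filter.Eventually.frequently h).filter_mono nhdsWithin_le_nhds)

/-- The identity theorem: a meromorphic function on the plane that vanishes near one point, that
point possibly excluded, represents zero. -/
theorem eventually_codiscrete_eq_zero {f : ℂ → ℂ} (hf : Meromorphic f) {x : ℂ}
    (hx : ∀ᶠ z in nhdsWithin x {x}ᶜ, f z = 0) : f =ᶠ[Filter.codiscrete ℂ] fun _ => 0 := by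
  have h : ∀ y, meromorphicOrderAt f y = ⊤ := by
    by_contra! h
    exact hf.exists_meromorphicOrderAt_ne_top_iff_forall.1 h x
      (meromorphicOrderAt_eq_top_iff.2 hx)
  change {z | f z = 0} ∈ Filter.codiscrete ℂ
  rw [mem_codiscrete]
  intro y
  rw [Filter.disjoint_principal_right, compl_compl]
  exact meromorphicOrderAt_eq_top_iff.1 (h y)

theorem eventually_codiscrete_ne_zero {f : ℂ → ℂ} (hf : Meromorphic f)
    (h0 : of f hf ≠ 0) : ∀ᶠ z in Filter.codiscrete ℂ, f z ≠ 0 := by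
  refine MeromorphicOn.eventually_codiscreteWithin_apply_ne_zero (fun x _ => hf x) fun x _ hx => h0 ?_
  rw [← of_zero]
  exact of_eq.2 (eventually_codiscrete_eq_zero hf (meromorphicOrderAt_eq_top_iff.1 hx))

instance : Nontrivial Mero := by
  refine ⟨0, 1, fun h => ?_⟩
  rw [← of_zero, ← of_one, of_eq] at h
  obtain ⟨x, hx⟩ := (dense_of_mem_codiscrete h).nonempty
  exact zero_ne_one hx

/-- Meromorphic functions form a field, by the identity theorem. -/
instance : Field Mero :=
  IsField.toField
    { exists_pair_ne := ⟨0, 1, zero_ne_one⟩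
      mul_comm := mul_comm
      mul_inv_cancel := by
        intro a ha
        obtain ⟨f, hf, rfl⟩ := exists_of a
        refine ⟨of f⁻¹ hf.inv, ?_⟩
        rw [of_mul, ← of_one, of_eq]
        filter_upwards [eventually_codiscrete_ne_zero hf ha] with z hz
        simp [hz] }

theorem D_mul (a b : Mero) : D (a * b) = D a * b + a * D b := by
  obtain ⟨f, hf, rfl⟩ := exists_of a
  obtain ⟨g, hg, rfl⟩ := exists_of b
  simp only [of_mul, D_of, of_add]
  refine of_eq.2 ?_
  filter_upwards [analytic_codiscrete hf, analytic_codiscrete hg] with x hx hy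
  exact deriv_mul hx.differentiableAt hy.differentiableAt

theorem D_X : D X = 1 := by
  have hm : Meromorphic fun x : ℂ => x := fun x => AnalyticAt.meromorphicAt (by fun_prop)
  exact of_congr (hf := hm.deriv) (hg := Meromorphic.const 1) fun x => deriv_id x

theorem D_exp (α : ℂ) : D (exp α) = α • exp α := by
  have hm : Meromorphic fun x => Complex.exp (α * x) :=
    fun x => AnalyticAt.meromorphicAt (by fun_prop)
  refine of_congr (hf := hm.deriv) (hg := hm.const_smul α) fun x => ?_
  have h : HasDerivAt (fun x : ℂ => Complex.exp (α * x)) (Complex.exp (α * x) * (α * 1)) x :=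
    ((hasDerivAt_id x).const_mul α).cexp
  rw [h.deriv, Pi.smul_apply, smul_eq_mul]
  ring

theorem exp_add (α β : ℂ) : exp (α + β) = exp α * exp β := by
  have hm (α : ℂ) : Meromorphic fun x => Complex.exp (α * x) :=
    fun x => AnalyticAt.meromorphicAt (by fun_prop)
  refine of_congr (hf := hm (α + β)) (hg := (hm α).mul (hm β)) fun x => ?_
  rw [Pi.mul_apply, ← Complex.exp_add, add_mul]

theorem exp_zero : exp 0 = 1 := by
  rw [← of_one]
  exact of_congr fun x => by simp

theorem exp_mul_exp_neg (α : ℂ) : exp α * exp (-α) = 1 := by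
  rw [← exp_add, add_neg_cancel, exp_zero]

theorem D_algebraMap (c : ℂ) : D (algebraMap ℂ Mero c) = 0 := by
  rw [algebraMap_eq_of, D_of, ← of_zero]
  exact of_congr fun x => deriv_const x c

theorem D_one : D 1 = 0 := by simpa using D_algebraMap 1

/-- The constants of the differential field of meromorphic functions are the complex numbers. -/
theorem exists_algebraMap_of_D_eq_zero {a : Mero} (ha : D a = 0) : ∃ c, a = algebraMap ℂ Mero c := by
  obtain ⟨f, hf, rfl⟩ := exists_of a
  rw [D_of, ← of_zero, of_eq] at ha
  obtain ⟨x, hx : AnalyticAt ℂ f x⟩ :=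
    (dense_of_mem_codiscrete (analytic_codiscrete hf)).nonempty
  have hx' : ∀ᶠ z in nhdsWithin x {x}ᶜ, deriv f z = 0 := by
    have h := mem_codiscrete.1 ha x
    rwa [Filter.disjoint_principal_right, compl_compl] at h
  have hd : ∀ᶠ z in nhds x, deriv f z = 0 :=
    (hx.deriv.frequently_eq_iff_eventually_eq analyticAt_const).1 hx'.frequently
  obtain ⟨r, hr, hball⟩ := Metric.eventually_nhds_iff_ball.1 (hd.and hx.eventually_analyticAt)
  refine ⟨f x, ?_⟩
  have hc : ∀ z ∈ Metric.ball x r, f z = f x := fun z hz =>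
    Metric.isOpen_ball.is_const_of_deriv_eq_zero (convex_ball x r).isPreconnected
      (fun w hw => (hball w hw).2.differentiableAt.differentiableWithinAt)
      (fun w hw => (hball w hw).1) hz (Metric.mem_ball_self hr)
  rw [algebraMap_eq_of, of_eq]
  have h0 : (fun z => f z - f x) =ᶠ[Filter.codiscrete ℂ] fun _ => 0 := by
    refine eventually_codiscrete_eq_zero (hf.sub (Meromorphic.const (f x))) (x := x) ?_
    refine Filter.Eventually.filter_mono nhdsWithin_le_nhds ?_
    filter_upwards [Metric.ball_mem_nhds x hr] with z hz
    rw [hc z hz, sub_self]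
  filter_upwards [h0] with z hz
  exact sub_eq_zero.1 hz

/-- The algebra of entire functions. -/
def Entire : Subalgebra ℂ (ℂ → ℂ) where
  carrier := {f | Differentiable ℂ f}
  mul_mem' hf hg := Differentiable.mul hf hg
  add_mem' hf hg := Differentiable.add hf hg
  algebraMap_mem' c := differentiable_const c

theorem Entire.meromorphic (f : Entire) : Meromorphic (f : ℂ → ℂ) :=
  fun x => (Differentiable.analyticAt f.2 x).meromorphicAt

/-- Entire functions as meromorphic functions. -/
def ofEntire : Entire →ₐ[ℂ] Mero where
  toFun f := of f (Entire.meromorphic f)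
  map_one' := rfl
  map_mul' _ _ := rfl
  map_zero' := rfl
  map_add' _ _ := rfl
  commutes' _ := rfl

theorem ofEntire_injective : Function.Injective ofEntire := by
  intro f g h
  have h' := (of_eq (hf := Entire.meromorphic f) (hg := Entire.meromorphic g)).1 h
  refine Subtype.ext ?_
  exact Continuous.ext_on (dense_of_mem_codiscrete h') (Differentiable.continuous f.2) (Differentiable.continuous g.2)
    fun x hx => hx

/-- Evaluation of entire functions at a point extends to a linear functional on all
meromorphic functions. -/
theorem exists_eval (x : ℂ) : ∃ ev : Mero →ₗ[ℂ] ℂ, ∀ f : Entire, ev (ofEntire f) = (f : ℂ → ℂ) x := by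
  obtain ⟨g, hg⟩ := LinearMap.exists_leftInverse_of_injective ofEntire.toLinearMap
    (LinearMap.ker_eq_bot.2 ofEntire_injective)
  refine ⟨((LinearMap.proj x : (ℂ → ℂ) →ₗ[ℂ] ℂ) ∘ₗ Entire.val.toLinearMap) ∘ₗ g, fun f => ?_⟩
  have : g (ofEntire f) = f := LinearMap.congr_fun hg f
  simp [this]

theorem aeval_X_eq (q : ℂ[X]) :
    Polynomial.aeval X q = ofEntire ⟨fun x => q.eval x, q.differentiable⟩ := by
  have h : Polynomial.aeval X q =
      ofEntire (Polynomial.aeval (⟨fun x => x, differentiable_id⟩ : Entire) q) := by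
    rw [← Polynomial.aeval_algHom_apply]; rfl
  rw [h]
  congr 1
  refine Subtype.ext (funext fun x => ?_)
  have h2 := Polynomial.aeval_algHom_apply ((Pi.evalAlgHom ℂ (fun _ : ℂ => ℂ) x).comp Entire.val)
    (⟨fun x => x, differentiable_id⟩ : Entire) q
  exact h2.symm

theorem aeval_X_ne_zero {q : ℂ[X]} (hq : q ≠ 0) : (Polynomial.aeval X q : Mero) ≠ 0 := by
  rw [aeval_X_eq]
  intro h
  refine hq (Polynomial.funext fun x => ?_)
  have h2 := congrArg Subtype.val (ofEntire_injective (h.trans (map_zero ofEntire).symm))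
  simpa using congrFun h2 x

end Mero

/-! ### Calculus of `R`-valued meromorphic functions -/

attribute [local instance] Algebra.TensorProduct.rightAlgebra

variable {R : Type*} [Ring R] [Algebra ℂ R]

namespace RMero

@[simp]
theorem D_tmul (r : R) (f : Mero) : RMero.D R (r ⊗ₜ f) = r ⊗ₜ Mero.D f := rfl

theorem op_smul_eq_mul_const (s : R) (f : RMero R) : MulOpposite.op s • f = f * const s := by
  induction f using TensorProduct.induction_on with
  | zero => simp
  | add f g hf hg => simp only [smul_add, add_mul, hf, hg]
  | tmul r u => simp [TensorProduct.smul_tmul', const]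

theorem smul_eq_tmul_mul (c : Mero) (f : RMero R) : c • f = ((1 : R) ⊗ₜ[ℂ] c) * f :=
  Algebra.smul_def c f

theorem smul_tmul (c : Mero) (r : R) (f : Mero) : c • (r ⊗ₜ[ℂ] f : RMero R) = r ⊗ₜ (c * f) := by
  simp [smul_eq_tmul_mul]

theorem D_mul (a b : RMero R) : D R (a * b) = D R a * b + a * D R b := by
  induction a using TensorProduct.induction_on with
  | zero => simp
  | add a a' ha ha' => simp only [add_mul, map_add, ha, ha']; abel
  | tmul r f =>
    induction b using TensorProduct.induction_on with
    | zero => simp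
    | add b b' hb hb' => simp only [mul_add, map_add, hb, hb']; abel
    | tmul s g =>
      simp [Algebra.TensorProduct.tmul_mul_tmul, Mero.D_mul, TensorProduct.tmul_add]

/-- `RMero R` is a differential module over `Mero`, the latter acting on the second tensor factor. -/
theorem D_smul (c : Mero) (f : RMero R) : D R (c • f) = Mero.D c • f + c • D R f := by
  simp only [smul_eq_tmul_mul, D_mul, D_tmul]

@[simp]
theorem D_const (r : R) : D R (const r) = 0 := by
  simp [const, Mero.D_one]

theorem const_injective : Function.Injective (const : R → RMero R) :=
  Algebra.TensorProduct.includeLeft_injective (S := ℂ) (algebraMap ℂ Mero).injective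

/-- The kernel of the derivative on `R ⊗ Mero` is `R`, by flatness of `R` over `ℂ`. -/
theorem exists_const_of_D_eq_zero {f : RMero R} (hf : D R f = 0) : ∃ r, f = const r := by
  have hex : Function.Exact (Algebra.linearMap ℂ Mero) Mero.D := by
    intro a
    refine ⟨fun h => ?_, ?_⟩
    · obtain ⟨c, rfl⟩ := Mero.exists_algebraMap_of_D_eq_zero h
      exact ⟨c, rfl⟩
    · rintro ⟨c, rfl⟩
      exact Mero.D_algebraMap c
  obtain ⟨g, rfl⟩ := (Module.Flat.lTensor_exact R hex f).1 hf
  clear hf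
  induction g using TensorProduct.induction_on with
  | zero => exact ⟨0, by simp [const]⟩
  | add a b ha hb =>
    obtain ⟨r, hr⟩ := ha
    obtain ⟨s, hs⟩ := hb
    exact ⟨r + s, by rw [map_add, hr, hs]; simp [const, TensorProduct.add_tmul]⟩
  | tmul r c =>
    refine ⟨c • r, ?_⟩
    rw [LinearMap.lTensor_tmul, Algebra.linearMap_apply, Algebra.algebraMap_eq_smul_one,
      ← TensorProduct.smul_tmul]
    rfl

theorem const_one : const (1 : R) = 1 := rfl

theorem const_zero : const (0 : R) = 0 := by simp [const]

end RMero

/-! ### Quasipolynomials -/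

open RMero

theorem commute_const_X (r : R) : Commute (Algebra.TensorProduct.includeLeftRingHom r : RMero R)
    ((1 : R) ⊗ₜ[ℂ] Mero.X) := by
  simp [Commute, SemiconjBy]

/-- The inclusion of polynomials into meromorphic functions as a ring homomorphism. -/
def ofPolyHom : R[X] →+* RMero R :=
  Polynomial.eval₂RingHom' Algebra.TensorProduct.includeLeftRingHom ((1 : R) ⊗ₜ[ℂ] Mero.X)
    commute_const_X

theorem ofPoly_eq (p : R[X]) : ofPoly p = ofPolyHom p := by
  change _ = Polynomial.eval₂ _ _ p
  rw [ofPoly, Polynomial.eval₂_eq_sum]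
  refine Finset.sum_congr rfl fun k _ => ?_
  simp [Algebra.TensorProduct.tmul_pow]

theorem quasiPoly_eq (p : R[X]) (α : ℂ) : quasiPoly p α = Mero.exp α • ofPolyHom p := by
  rw [← ofPoly_eq, ofPoly, Polynomial.sum_def, Finset.smul_sum, quasiPoly, Polynomial.sum_def]
  refine Finset.sum_congr rfl fun k _ => ?_
  rw [RMero.smul_tmul, mul_comm]

theorem ofPolyHom_C (r : R) : ofPolyHom (Polynomial.C r) = const r := by
  exact Polynomial.eval₂_C _ _

theorem ofPolyHom_monomial (n : ℕ) (r : R) :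
    ofPolyHom (Polynomial.monomial n r) = r ⊗ₜ[ℂ] (Mero.X ^ n) := by
  rw [← ofPoly_eq, ofPoly, Polynomial.sum_monomial_index _ _ (by simp)]

theorem ofPolyHom_map (q : ℂ[X]) :
    ofPolyHom (q.map (algebraMap ℂ R)) = (1 : R) ⊗ₜ[ℂ] Polynomial.aeval Mero.X q := by
  induction q using Polynomial.induction_on' with
  | add p q hp hq => simp only [Polynomial.map_add, map_add, hp, hq, TensorProduct.tmul_add]
  | monomial n a =>
    rw [Polynomial.map_monomial, ofPolyHom_monomial, Polynomial.aeval_monomial,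
      Algebra.algebraMap_eq_smul_one, ← Algebra.smul_def, TensorProduct.smul_tmul]

theorem D_ofPolyHom (p : R[X]) : RMero.D R (ofPolyHom p) = ofPolyHom (Polynomial.derivative p) := by
  induction p using Polynomial.induction_on' with
  | add p q hp hq => simp only [map_add, hp, hq]
  | monomial n r =>
    rw [Polynomial.derivative_monomial, ofPolyHom_monomial, ofPolyHom_monomial, D_tmul]
    have h : Mero.D (Mero.X ^ n) = (n : ℂ) • Mero.X ^ (n - 1) := by
      induction n with
      | zero => simp [Mero.D_one]
      | succ n ih =>
        rw [pow_succ, Mero.D_mul, ih, Mero.D_X]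
        rcases n with _ | n
        · simp
        · rw [Nat.add_sub_cancel, Nat.add_sub_cancel, mul_one, smul_mul_assoc, ← pow_succ,
            Nat.cast_succ (n + 1), add_smul, one_smul]
    rw [h, ← TensorProduct.smul_tmul]
    congr 1
    rw [Algebra.smul_def, map_natCast, (Nat.cast_commute n r).eq]

theorem D_quasiPoly (p : R[X]) (α : ℂ) :
    RMero.D R (quasiPoly p α) = quasiPoly (Polynomial.derivative p + α • p) α := by
  have h : ofPolyHom (α • p) = α • ofPolyHom p := by
    have : α • p = Polynomial.C (algebraMap ℂ R α) * p := by
      rw [← Polynomial.smul_eq_C_mul, algebraMap_smul]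
    rw [this, map_mul, ofPolyHom_C, Algebra.smul_def]
    rfl
  rw [quasiPoly_eq, quasiPoly_eq, D_smul, D_ofPolyHom, Mero.D_exp, map_add, h, smul_add, add_comm,
    smul_assoc, smul_comm]

theorem quasiPoly_mul_C (p : R[X]) (s : R) (α : ℂ) :
    quasiPoly (p * Polynomial.C s) α = MulOpposite.op s • quasiPoly p α := by
  rw [quasiPoly_eq, quasiPoly_eq, map_mul, ofPolyHom_C, op_smul_eq_mul_const, smul_mul_assoc]

theorem quasiPoly_add (p q : R[X]) (α : ℂ) :
    quasiPoly (p + q) α = quasiPoly p α + quasiPoly q α := by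
  simp only [quasiPoly_eq, map_add, smul_add]

theorem quasiPoly_zero (α : ℂ) : quasiPoly (0 : R[X]) α = 0 := by
  simp only [quasiPoly_eq, map_zero, smul_zero]

theorem quasiPoly_mem_expComponent (p : R[X]) (α : ℂ) : quasiPoly p α ∈ expComponent R α := ⟨p, rfl⟩

theorem quasiPoly_mem_quasiPolys (p : R[X]) (α : ℂ) : quasiPoly p α ∈ quasiPolys R :=
  le_iSup (expComponent R) α (quasiPoly_mem_expComponent p α)

/-- On `R[x] exp (α x)` the operator `∂ - β` acts as `p ↦ p' + (α - β) p`. -/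
theorem D_sub_smul_quasiPoly (p : R[X]) (α β : ℂ) :
    (RMero.D R - algebraMap ℂ (Module.End Rᵐᵒᵖ (RMero R)) β) (quasiPoly p α) =
      quasiPoly (Polynomial.derivative p + (α - β) • p) α := by
  have h : β • quasiPoly p α = quasiPoly (β • p) α := by
    rw [← one_smul ℂ (quasiPoly p α)]
    have : β • p = p * Polynomial.C (algebraMap ℂ R β) := by
      rw [← algebraMap_smul R, Polynomial.smul_eq_C_mul]
      ext n
      simp [Algebra.commutes]
    rw [this, quasiPoly_mul_C, op_smul_eq_mul_const, one_smul, Algebra.smul_def,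
      Algebra.commutes]
    rfl
  rw [LinearMap.sub_apply, Module.algebraMap_end_apply, D_quasiPoly, h, sub_smul,
    sub_eq_iff_eq_add, ← quasiPoly_add]
  congr 1
  abel

theorem exists_pow_quasiPoly_eq_zero (p : R[X]) (α : ℂ) : ∃ k : ℕ,
    ((RMero.D R - algebraMap ℂ (Module.End Rᵐᵒᵖ (RMero R)) α) ^ k) (quasiPoly p α) = 0 := by
  refine ⟨p.natDegree + 1, ?_⟩
  have h : ∀ k, ((RMero.D R - algebraMap ℂ (Module.End Rᵐᵒᵖ (RMero R)) α) ^ k) (quasiPoly p α) =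
      quasiPoly (Polynomial.derivative^[k] p) α := by
    intro k
    induction k with
    | zero => simp
    | succ k ih =>
      rw [pow_succ', Module.End.mul_apply, ih, D_sub_smul_quasiPoly, sub_self, zero_smul, add_zero,
        Function.iterate_succ_apply']
  rw [h, Polynomial.iterate_derivative_eq_zero (Nat.lt_succ_self _), quasiPoly_zero]

/-- The sum of the modules `R[x] exp (α x)` is direct: they lie in distinct generalized eigenspaces
of the derivative. -/
theorem iSupIndep_expComponent : iSupIndep (expComponent R) := by
  have key := Module.End.independent_maxGenEigenspace ((RMero.D R).restrictScalars ℂ)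
  have hle : ∀ α, ∀ f ∈ expComponent R α,
      f ∈ Module.End.maxGenEigenspace ((RMero.D R).restrictScalars ℂ) α := by
    rintro α _ ⟨p, rfl⟩
    obtain ⟨k, hk⟩ := exists_pow_quasiPoly_eq_zero p α
    refine (Module.End.mem_maxGenEigenspace _ _ _).2 ⟨k, ?_⟩
    rw [← hk]
    clear hk
    induction k with
    | zero => rfl
    | succ k ih => rw [pow_succ', pow_succ', Module.End.mul_apply, Module.End.mul_apply, ih]; rfl
  intro α
  rw [Submodule.disjoint_def]
  intro f hf hf'
  refine (Submodule.disjoint_def.1 (key α)) f (hle α f hf) ?_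
  clear hf
  induction hf' using Submodule.iSup_induction' with
  | zero => exact zero_mem _
  | add x y _ _ hx hy => exact add_mem hx hy
  | mem β x hx =>
    by_cases hβ : β ≠ α
    · rw [iSup_pos hβ] at hx
      exact Submodule.mem_iSup_of_mem β (Submodule.mem_iSup_of_mem hβ (hle β x hx))
    · rw [iSup_neg hβ] at hx
      rw [(Submodule.mem_bot _).1 hx]
      exact zero_mem _

/-- The equation `q' + c q = p` is solvable in polynomials, so `∂ - β` is surjective on
quasipolynomials; on all meromorphic functions it is not, as `1 / x` shows. -/
theorem exists_derivative_add_smul_eq (c : ℂ) (p : R[X]) :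
    ∃ q : R[X], Polynomial.derivative q + c • q = p := by
  induction p using Polynomial.induction_on' with
  | add p q hp hq =>
    obtain ⟨p', rfl⟩ := hp
    obtain ⟨q', rfl⟩ := hq
    exact ⟨p' + q', by rw [Polynomial.derivative_add, smul_add]; abel⟩
  | monomial n r =>
    by_cases hc : c = 0
    · refine ⟨Polynomial.monomial (n + 1) (((n : ℂ) + 1)⁻¹ • r), ?_⟩
      have h : (((n : ℂ) + 1)⁻¹ • r) * ((n + 1 : ℕ) : R) = r := by
        rw [show ((n + 1 : ℕ) : R) = algebraMap ℂ R ((n : ℂ) + 1) by simp, smul_mul_assoc,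
          ← Algebra.commutes, ← Algebra.smul_def, smul_smul, inv_mul_cancel₀, one_smul]
        exact Nat.cast_add_one_ne_zero n
      rw [hc, zero_smul, add_zero, Polynomial.derivative_monomial, h, Nat.add_sub_cancel]
    · induction n generalizing r with
      | zero =>
        refine ⟨Polynomial.monomial 0 (c⁻¹ • r), ?_⟩
        rw [Polynomial.derivative_monomial, Polynomial.smul_monomial, smul_smul,
          mul_inv_cancel₀ hc]
        simp
      | succ n ih =>
        obtain ⟨q, hq⟩ := ih (-(c⁻¹ • r * ((n + 1 : ℕ) : R)))
        refine ⟨Polynomial.monomial (n + 1) (c⁻¹ • r) + q, ?_⟩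
        rw [Polynomial.derivative_add, smul_add, add_add_add_comm, hq,
          Polynomial.derivative_monomial, Polynomial.smul_monomial, smul_smul,
          mul_inv_cancel₀ hc, one_smul, Nat.add_sub_cancel, map_neg]
        abel

/-! ### Operators with constant scalar coefficients -/

theorem exists_quasiPolys_D_sub_smul_eq (β : ℂ) {f : RMero R} (hf : f ∈ quasiPolys R) :
    ∃ g ∈ quasiPolys R,
      (RMero.D R - algebraMap ℂ (Module.End Rᵐᵒᵖ (RMero R)) β) g = f := by
  induction hf using Submodule.iSup_induction' with
  | zero => exact ⟨0, zero_mem _, map_zero _⟩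
  | add x y _ _ hx hy =>
    obtain ⟨x', hx', rfl⟩ := hx
    obtain ⟨y', hy', rfl⟩ := hy
    exact ⟨x' + y', add_mem hx' hy', map_add _ _ _⟩
  | mem α x hx =>
    obtain ⟨p, rfl⟩ := hx
    obtain ⟨q, hq⟩ := exists_derivative_add_smul_eq (α - β) p
    exact ⟨quasiPoly q α, quasiPoly_mem_quasiPolys q α, by rw [D_sub_smul_quasiPoly, hq]⟩

theorem D_sub_smul_eq_zero_iff (β : ℂ) (f : RMero R) :
    (RMero.D R - algebraMap ℂ (Module.End Rᵐᵒᵖ (RMero R)) β) f = 0 ↔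
      ∃ r : R, f = quasiPoly (Polynomial.C r) β := by
  constructor
  · intro h
    rw [LinearMap.sub_apply, Module.algebraMap_end_apply, sub_eq_zero] at h
    have h0 : RMero.D R (Mero.exp (-β) • f) = 0 := by
      rw [D_smul, h, Mero.D_exp, smul_assoc, neg_smul, smul_comm β, neg_add_cancel]
    obtain ⟨r, hr⟩ := exists_const_of_D_eq_zero h0
    refine ⟨r, ?_⟩
    rw [quasiPoly_eq, ofPolyHom_C, ← hr, smul_smul, Mero.exp_mul_exp_neg, one_smul]
  · rintro ⟨r, rfl⟩
    rw [D_sub_smul_quasiPoly, sub_self, zero_smul, Polynomial.derivative_C, add_zero,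
      quasiPoly_zero]

/-- An operator that is surjective on the quasipolynomials, has only quasipolynomials in its
kernel, and whose kernel has dimension `n · dim R`. The condition on the kernel is stated in a form
that is stable under composition, and the dimension as a cardinal, which makes rank-nullity
available before the kernel is known to be finite dimensional. -/
structure IsFullOp (n : ℕ) (T : Module.End Rᵐᵒᵖ (RMero R)) : Prop where
  surj : ∀ f ∈ quasiPolys R, ∃ g ∈ quasiPolys R, T g = f
  mem_of_mem : ∀ f, T f ∈ quasiPolys R → f ∈ quasiPolys R
  rank_ker : Module.rank ℂ (LinearMap.ker T) = n * Module.rank ℂ R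

theorem IsFullOp.one : IsFullOp 0 (1 : Module.End Rᵐᵒᵖ (RMero R)) where
  surj f hf := ⟨f, hf, rfl⟩
  mem_of_mem f hf := hf
  rank_ker := by
    have : LinearMap.ker (1 : Module.End Rᵐᵒᵖ (RMero R)) = ⊥ := LinearMap.ker_id
    rw [this]
    simp

theorem IsFullOp.mul {n m : ℕ} {S T : Module.End Rᵐᵒᵖ (RMero R)} (hS : IsFullOp n S)
    (hT : IsFullOp m T) : IsFullOp (n + m) (S * T) where
  surj f hf := by
    obtain ⟨g, hg, rfl⟩ := hS.surj f hf
    obtain ⟨h, hh, rfl⟩ := hT.surj g hg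
    exact ⟨h, hh, rfl⟩
  mem_of_mem f hf := hT.mem_of_mem f (hS.mem_of_mem _ hf)
  rank_ker := by
    let φ : LinearMap.ker (S * T) →ₗ[ℂ] LinearMap.ker S :=
      { toFun := fun f => ⟨T f, f.2⟩
        map_add' := fun f g => Subtype.ext (map_add T f.1 g.1)
        map_smul' := fun c f => Subtype.ext (LinearMap.map_smul_of_tower T c f.1) }
    have hsurj : Function.Surjective φ := by
      rintro ⟨f, hf⟩
      have hf' : f ∈ quasiPolys R := hS.mem_of_mem f (by
        rw [LinearMap.mem_ker.1 hf]; exact zero_mem _)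
      obtain ⟨g, hg, rfl⟩ := hT.surj f hf'
      exact ⟨⟨g, hf⟩, rfl⟩
    have hle : LinearMap.ker T ≤ LinearMap.ker (S * T) := fun f hf => by
      rw [LinearMap.mem_ker, Module.End.mul_apply, LinearMap.mem_ker.1 hf, map_zero]
    let ψ : LinearMap.ker φ ≃ₗ[ℂ] LinearMap.ker T :=
      { toFun := fun f => ⟨f.1.1, congrArg Subtype.val f.2⟩
        invFun := fun f => ⟨⟨f.1, hle f.2⟩, Subtype.ext f.2⟩
        map_add' := fun _ _ => rfl
        map_smul' := fun _ _ => rfl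
        left_inv := fun _ => rfl
        right_inv := fun _ => rfl }
    rw [← LinearMap.rank_range_add_rank_ker φ, ψ.rank_eq, hT.rank_ker,
      LinearMap.range_eq_top.2 hsurj, rank_top, hS.rank_ker, Nat.cast_add, add_mul]

theorem IsFullOp.D_sub_smul (β : ℂ) :
    IsFullOp 1 (RMero.D R - algebraMap ℂ (Module.End Rᵐᵒᵖ (RMero R)) β) where
  surj f hf := exists_quasiPolys_D_sub_smul_eq β hf
  mem_of_mem f hf := by
    obtain ⟨g, hg, h⟩ := exists_quasiPolys_D_sub_smul_eq β hf
    rw [← sub_eq_zero, ← map_sub, D_sub_smul_eq_zero_iff] at h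
    obtain ⟨r, hr⟩ := h
    have : f = g - quasiPoly (Polynomial.C r) β := by rw [← hr]; abel
    rw [this]
    exact sub_mem hg (quasiPoly_mem_quasiPolys _ _)
  rank_ker := by
    let φ : R →ₗ[ℂ] LinearMap.ker (RMero.D R - algebraMap ℂ (Module.End Rᵐᵒᵖ (RMero R)) β) :=
      { toFun := fun r => ⟨quasiPoly (Polynomial.C r) β, (D_sub_smul_eq_zero_iff β _).2 ⟨r, rfl⟩⟩
        map_add' := fun r s => Subtype.ext (by simp only [map_add, quasiPoly_add]; rfl)
        map_smul' := fun c r => Subtype.ext (by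
          change quasiPoly (Polynomial.C (c • r)) β = c • quasiPoly (Polynomial.C r) β
          rw [quasiPoly_eq, quasiPoly_eq, smul_comm, ofPolyHom_C, ofPolyHom_C]
          rfl) }
    have hφ : Function.Bijective φ := by
      constructor
      · intro r s h
        have h := congrArg Subtype.val h
        change quasiPoly (Polynomial.C r) β = quasiPoly (Polynomial.C s) β at h
        rw [quasiPoly_eq, quasiPoly_eq, ofPolyHom_C, ofPolyHom_C] at h
        have h := congrArg (fun f => Mero.exp (-β) • f) h
        simp only [smul_smul, mul_comm (Mero.exp (-β)), Mero.exp_mul_exp_neg, one_smul] at h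
        exact const_injective h
      · rintro ⟨f, hf⟩
        obtain ⟨r, rfl⟩ := (D_sub_smul_eq_zero_iff β f).1 hf
        exact ⟨r, rfl⟩
    rw [← (LinearEquiv.ofBijective φ hφ).rank_eq, Nat.cast_one, one_mul]

theorem isFullOp_aeval_D {χ : ℂ[X]} (hχ : χ.Monic) :
    IsFullOp χ.natDegree (Polynomial.aeval (RMero.D R) χ) := by
  have key : ∀ s : Multiset ℂ, IsFullOp s.card
      (Polynomial.aeval (RMero.D R) (s.map fun a => Polynomial.X - Polynomial.C a).prod) := by
    intro s
    induction s using Multiset.induction_on with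
    | empty => simpa using IsFullOp.one
    | cons a s ih =>
      rw [Multiset.map_cons, Multiset.prod_cons, map_mul, Multiset.card_cons, add_comm]
      refine IsFullOp.mul ?_ ih
      simpa using IsFullOp.D_sub_smul a
  have h := key χ.roots
  rwa [← (IsAlgClosed.splits χ).eq_prod_roots_of_monic hχ,
    ← (IsAlgClosed.splits χ).natDegree_eq_card_roots] at h

theorem ker_aeval_D_le_quasiPolys {χ : ℂ[X]} (hχ : χ.Monic) :
    LinearMap.ker (Polynomial.aeval (RMero.D R) χ) ≤ quasiPolys R := fun f hf =>
  (isFullOp_aeval_D hχ).mem_of_mem f (by rw [LinearMap.mem_ker.1 hf]; exact zero_mem _)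

/-- Every quasipolynomial is annihilated by a nonzero operator with constant scalar coefficients. -/
theorem exists_aeval_D_eq_zero {f : RMero R} (hf : f ∈ quasiPolys R) :
    ∃ χ : ℂ[X], χ.Monic ∧ Polynomial.aeval (RMero.D R) χ f = 0 := by
  induction hf using Submodule.iSup_induction' with
  | zero => exact ⟨1, Polynomial.monic_one, map_zero _⟩
  | add x y _ _ hx hy =>
    obtain ⟨p, hp, hpx⟩ := hx
    obtain ⟨q, hq, hqy⟩ := hy
    refine ⟨p * q, hp.mul hq, ?_⟩
    have h : Polynomial.aeval (RMero.D R) (p * q) x = 0 := by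
      rw [mul_comm, map_mul, Module.End.mul_apply, hpx, map_zero]
    rw [map_add, h, map_mul, Module.End.mul_apply, hqy, map_zero, add_zero]
  | mem α x hx =>
    obtain ⟨p, rfl⟩ := hx
    obtain ⟨k, hk⟩ := exists_pow_quasiPoly_eq_zero p α
    refine ⟨(Polynomial.X - Polynomial.C α) ^ k, (Polynomial.monic_X_sub_C α).pow k, ?_⟩
    simpa using hk

theorem finiteDimensional_ker_aeval_D [FiniteDimensional ℂ R] {χ : ℂ[X]} (hχ : χ.Monic) :
    FiniteDimensional ℂ (LinearMap.ker (Polynomial.aeval (RMero.D R) χ)) := by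
  rw [FiniteDimensional, ← Module.rank_lt_aleph0_iff, (isFullOp_aeval_D hχ).rank_ker]
  exact Cardinal.mul_lt_aleph0 (Cardinal.natCast_lt_aleph0) (Module.rank_lt_aleph0 ℂ R)

theorem finrank_ker_aeval_D [FiniteDimensional ℂ R] {χ : ℂ[X]} (hχ : χ.Monic) :
    Module.finrank ℂ (LinearMap.ker (Polynomial.aeval (RMero.D R) χ)) =
      χ.natDegree * Module.finrank ℂ R := by
  refine Module.finrank_eq_of_rank_eq ?_
  rw [(isFullOp_aeval_D hχ).rank_ker, ← Module.finrank_eq_rank]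
  norm_cast

/-! ### The algebra of differential operators over a differential ring of coefficients -/

theorem RMero.mulLeft_add (a b : RMero R) : mulLeft (a + b) = mulLeft a + mulLeft b :=
  LinearMap.ext fun f => add_mul a b f

theorem RMero.mulLeft_zero : mulLeft (0 : RMero R) = 0 :=
  LinearMap.ext fun f => zero_mul f

theorem RMero.mulLeft_one : mulLeft (1 : RMero R) = 1 :=
  LinearMap.ext fun f => one_mul f

theorem RMero.mulLeft_mul (a b : RMero R) : mulLeft (a * b) = mulLeft a * mulLeft b :=
  LinearMap.ext fun f => mul_assoc a b f

theorem RMero.D_mul_mulLeft (a : RMero R) :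
    RMero.D R * mulLeft a = mulLeft a * RMero.D R + mulLeft (RMero.D R a) :=
  LinearMap.ext fun f => by
    change RMero.D R (a * f) = a * RMero.D R f + RMero.D R a * f
    rw [RMero.D_mul, add_comm]

theorem diffOp_eq_sum_range (n : ℕ) (a : ℕ → RMero R) :
    diffOp (fun k : Fin n => a k) = ∑ k ∈ Finset.range n, mulLeft (a k) * RMero.D R ^ k :=
  (Finset.sum_range fun k => mulLeft (a k) * RMero.D R ^ k).symm

theorem diffOp_add {n : ℕ} (a b : Fin n → RMero R) : diffOp (a + b) = diffOp a + diffOp b := by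
  simp only [diffOp, Pi.add_apply, mulLeft_add, add_mul, Finset.sum_add_distrib]

theorem diffOp_zero {n : ℕ} : diffOp (0 : Fin n → RMero R) = 0 := by
  simp [diffOp, mulLeft_zero]

theorem diffOp_neg {n : ℕ} (a : Fin n → RMero R) : diffOp (-a) = -diffOp a :=
  eq_neg_of_add_eq_zero_left (by rw [← diffOp_add, neg_add_cancel, diffOp_zero])

theorem diffOp_apply {n : ℕ} (a : Fin n → RMero R) (f : RMero R) :
    diffOp a f = ∑ k, a k * (RMero.D R ^ (k : ℕ)) f := by
  simp only [diffOp, LinearMap.sum_apply]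
  rfl

theorem D_pow_exp (k : ℕ) (z : ℂ) :
    (RMero.D R ^ k) ((1 : R) ⊗ₜ Mero.exp z) = z ^ k • ((1 : R) ⊗ₜ Mero.exp z) := by
  induction k with
  | zero => simp
  | succ k ih =>
    rw [pow_succ', Module.End.mul_apply, ih, LinearMap.map_smul_of_tower, D_tmul, Mero.D_exp,
      TensorProduct.tmul_smul, smul_smul, pow_succ]

/-- A differential operator is determined by its action on the exponentials `exp (z x)`. -/
theorem eq_zero_of_diffOp_exp_eq_zero {n : ℕ} (a : Fin n → RMero R)
    (h : ∀ z, diffOp a ((1 : R) ⊗ₜ Mero.exp z) = 0) : a = 0 := by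
  -- cancelling `exp (z x)` leaves a polynomial in `z` with coefficients `a k`
  have h1 : ∀ z : ℂ, ∑ k : Fin n, z ^ (k : ℕ) • a k = 0 := by
    intro z
    have h2 := congrArg (fun f => Mero.exp (-z) • f) (h z)
    simp only [diffOp_apply, D_pow_exp, smul_zero, Finset.smul_sum] at h2
    rw [← h2]
    refine Finset.sum_congr rfl fun k _ => ?_
    rw [mul_smul_comm, smul_comm, ← mul_smul_comm (Mero.exp (-z)), RMero.smul_tmul,
      mul_comm (Mero.exp (-z)), Mero.exp_mul_exp_neg]
    exact congrArg _ (mul_one _).symm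
  funext k
  refine (Module.forall_dual_apply_eq_zero_iff ℂ (a k)).1 fun φ => ?_
  have h3 : (∑ k : Fin n, Polynomial.monomial (k : ℕ) (φ (a k)) : ℂ[X]) = 0 := by
    refine Polynomial.funext fun z => ?_
    rw [Polynomial.eval_finsetSum, Polynomial.eval_zero, ← map_zero φ, ← h1 z, map_sum]
    refine Finset.sum_congr rfl fun k _ => ?_
    rw [Polynomial.eval_monomial, map_smul, smul_eq_mul, mul_comm]
  have h4 := congrArg (fun p => Polynomial.coeff p (k : ℕ)) h3
  simp only [Polynomial.finsetSum_coeff, Polynomial.coeff_monomial, Fin.val_inj,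
    Polynomial.coeff_zero] at h4
  simpa using h4

theorem diffOp_injective {n : ℕ} : Function.Injective (diffOp : (Fin n → RMero R) → _) := by
  intro a b h
  rw [← sub_eq_zero]
  refine eq_zero_of_diffOp_exp_eq_zero _ fun z => ?_
  rw [sub_eq_add_neg, diffOp_add, diffOp_neg, h, add_neg_cancel, LinearMap.zero_apply]

/-- The operators of order less than `n` with coefficients in the subring `S`. Accordingly `P` is
monic of order `n` over `S` when `P - ∂ ^ n` lies in `opsLT S n`. -/
def opsLT (S : Subring (RMero R)) (n : ℕ) : AddSubgroup (Module.End Rᵐᵒᵖ (RMero R)) where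
  carrier := {T | ∃ a : Fin n → RMero R, (∀ k, a k ∈ S) ∧ T = diffOp a}
  zero_mem' := ⟨0, fun _ => S.zero_mem, diffOp_zero.symm⟩
  add_mem' := by
    rintro _ _ ⟨a, ha, rfl⟩ ⟨b, hb, rfl⟩
    exact ⟨a + b, fun k => S.add_mem (ha k) (hb k), (diffOp_add a b).symm⟩
  neg_mem' := by
    rintro _ ⟨a, ha, rfl⟩
    exact ⟨-a, fun k => S.neg_mem (ha k), (diffOp_neg a).symm⟩

section opsLT

variable {S : Subring (RMero R)}

theorem monomial_mem_opsLT {a : RMero R} (ha : a ∈ S) {k n : ℕ} (hk : k < n) :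
    mulLeft a * RMero.D R ^ k ∈ opsLT S n := by
  refine ⟨fun j => if (j : ℕ) = k then a else 0, fun j => ?_, ?_⟩
  · dsimp only
    split_ifs
    exacts [ha, S.zero_mem]
  · rw [diffOp_eq_sum_range n fun j => if j = k then a else 0,
      Finset.sum_eq_single_of_mem k (Finset.mem_range.2 hk) fun j _ hj => by
        rw [if_neg hj, mulLeft_zero, zero_mul], if_pos rfl]

theorem opsLT_mono {m n : ℕ} (h : m ≤ n) : opsLT S m ≤ opsLT S n := by
  rintro _ ⟨a, ha, rfl⟩
  exact sum_mem fun k _ => monomial_mem_opsLT (ha k) (k.2.trans_le h)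

theorem opsLT_le_of_le {S' : Subring (RMero R)} (h : S ≤ S') (n : ℕ) :
    opsLT S n ≤ opsLT S' n := by
  rintro _ ⟨a, ha, rfl⟩
  exact ⟨a, fun k => h (ha k), rfl⟩

theorem opsLT_succ {n : ℕ} {T : Module.End Rᵐᵒᵖ (RMero R)} (hT : T ∈ opsLT S (n + 1)) :
    ∃ a ∈ S, ∃ T' ∈ opsLT S n, T = T' + mulLeft a * RMero.D R ^ n := by
  obtain ⟨a, ha, rfl⟩ := hT
  refine ⟨a (Fin.last n), ha _, diffOp fun k => a k.castSucc, ⟨_, fun k => ha _, rfl⟩, ?_⟩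
  exact Fin.sum_univ_castSucc _

theorem opsLT_zero {T : Module.End Rᵐᵒᵖ (RMero R)} (hT : T ∈ opsLT S 0) : T = 0 := by
  obtain ⟨a, -, rfl⟩ := hT
  simp [diffOp]

theorem mulLeft_mul_mem_opsLT {a : RMero R} (ha : a ∈ S) {n : ℕ}
    {T : Module.End Rᵐᵒᵖ (RMero R)} (hT : T ∈ opsLT S n) : mulLeft a * T ∈ opsLT S n := by
  obtain ⟨b, hb, rfl⟩ := hT
  refine ⟨fun k => a * b k, fun k => S.mul_mem ha (hb k), ?_⟩
  simp only [diffOp, Finset.mul_sum, mulLeft_mul, mul_assoc]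

theorem eq_zero_of_monomial_mem_opsLT {a : RMero R} {n : ℕ}
    (h : mulLeft a * RMero.D R ^ n ∈ opsLT S n) : a = 0 := by
  obtain ⟨b, -, hb⟩ := h
  have h1 : diffOp (Fin.snoc (-b) a : Fin (n + 1) → RMero R) =
      diffOp (0 : Fin (n + 1) → RMero R) := by
    have h2 : diffOp (Fin.snoc (-b) a : Fin (n + 1) → RMero R) =
        diffOp (-b) + mulLeft a * RMero.D R ^ n := by
      refine (Fin.sum_univ_castSucc _).trans ?_
      congr 1
      · exact Finset.sum_congr rfl fun k _ => by rw [Fin.snoc_castSucc]; rfl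
      · rw [Fin.snoc_last]; rfl
    rw [h2, hb, diffOp_neg, neg_add_cancel, diffOp_zero]
  have h3 := congrFun (diffOp_injective h1) (Fin.last n)
  rwa [Fin.snoc_last] at h3

variable (hS : ∀ a ∈ S, RMero.D R a ∈ S)
include hS

theorem D_mul_mem_opsLT {n : ℕ} {T : Module.End Rᵐᵒᵖ (RMero R)} (hT : T ∈ opsLT S n) :
    RMero.D R * T ∈ opsLT S (n + 1) := by
  obtain ⟨a, ha, rfl⟩ := hT
  rw [diffOp, Finset.mul_sum]
  refine sum_mem fun k _ => ?_
  rw [← mul_assoc, D_mul_mulLeft, add_mul, mul_assoc, ← pow_succ']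
  exact add_mem (monomial_mem_opsLT (ha k) (by omega))
    (monomial_mem_opsLT (hS _ (ha k)) (by omega))

theorem D_pow_mul_mem_opsLT {n : ℕ} {T : Module.End Rᵐᵒᵖ (RMero R)} (hT : T ∈ opsLT S n) (k : ℕ) :
    RMero.D R ^ k * T ∈ opsLT S (k + n) := by
  induction k with
  | zero => simpa using hT
  | succ k ih =>
    rw [pow_succ', mul_assoc, add_right_comm]
    exact D_mul_mem_opsLT hS ih

theorem mul_mem_opsLT {m n : ℕ} {T U : Module.End Rᵐᵒᵖ (RMero R)} (hT : T ∈ opsLT S m)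
    (hU : U ∈ opsLT S n) : T * U ∈ opsLT S (m + n) := by
  obtain ⟨a, ha, rfl⟩ := hT
  rw [diffOp, Finset.sum_mul]
  refine sum_mem fun k _ => ?_
  rw [mul_assoc]
  exact mulLeft_mul_mem_opsLT (ha k)
    (opsLT_mono (by omega) (D_pow_mul_mem_opsLT hS hU k))

theorem D_pow_mul_monic {n : ℕ} {P : Module.End Rᵐᵒᵖ (RMero R)} (hP : P - RMero.D R ^ n ∈ opsLT S n)
    (k : ℕ) : RMero.D R ^ k * P - RMero.D R ^ (k + n) ∈ opsLT S (k + n) := by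
  rw [pow_add, ← mul_sub]
  exact D_pow_mul_mem_opsLT hS hP k

/-- Right division with remainder by a monic operator. -/
theorem exists_eq_mul_add_of_monic {n : ℕ} {P : Module.End Rᵐᵒᵖ (RMero R)}
    (hP : P - RMero.D R ^ n ∈ opsLT S n) {m : ℕ} {T : Module.End Rᵐᵒᵖ (RMero R)}
    (hT : T ∈ opsLT S m) : ∃ Q ∈ opsLT S m, ∃ U ∈ opsLT S n, T = Q * P + U := by
  induction m generalizing T with
  | zero => exact ⟨0, zero_mem _, 0, zero_mem _, by rw [opsLT_zero hT]; simp⟩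
  | succ m ih =>
    by_cases hm : m + 1 ≤ n
    · exact ⟨0, zero_mem _, T, opsLT_mono hm hT, by simp⟩
    · obtain ⟨a, ha, T', hT', rfl⟩ := opsLT_succ hT
      have h1 := mulLeft_mul_mem_opsLT ha (D_pow_mul_monic hS hP (m - n))
      rw [Nat.sub_add_cancel (by omega)] at h1
      obtain ⟨Q, hQ, U, hU, h⟩ := ih (sub_mem hT' h1)
      refine ⟨Q + mulLeft a * RMero.D R ^ (m - n), add_mem (opsLT_mono m.le_succ hQ)
        (monomial_mem_opsLT ha (by omega)), U, hU, ?_⟩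
      rw [sub_eq_iff_eq_add] at h
      rw [h, mul_sub, add_mul, mul_assoc]
      abel

/-- Right multiplication by a monic operator of order `n` raises the order by exactly `n`, because it
preserves the leading coefficient. -/
theorem mem_opsLT_of_mul_monic_mem {n : ℕ} {P : Module.End Rᵐᵒᵖ (RMero R)}
    (hP : P - RMero.D R ^ n ∈ opsLT S n) {m k : ℕ} {T : Module.End Rᵐᵒᵖ (RMero R)}
    (hT : T ∈ opsLT S m) (h : T * P ∈ opsLT S (k + n)) : T ∈ opsLT S k := by
  induction m generalizing T with
  | zero => exact opsLT_mono (Nat.zero_le k) hT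
  | succ m ih =>
    by_cases hm : m + 1 ≤ k
    · exact opsLT_mono hm hT
    · obtain ⟨a, ha, T', hT', rfl⟩ := opsLT_succ hT
      have h1 : mulLeft a * RMero.D R ^ (m + n) ∈ opsLT S (m + n) := by
        have h2 := mulLeft_mul_mem_opsLT ha (D_pow_mul_monic hS hP m)
        have hP' : P ∈ opsLT S (n + 1) := by
          have := add_mem (opsLT_mono n.le_succ hP)
            (monomial_mem_opsLT (S := S) S.one_mem n.lt_succ_self)
          rwa [mulLeft_one, one_mul, sub_add_cancel] at this
        have h3 : T' * P ∈ opsLT S (m + n) := by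
          have h4 : T' * (P - RMero.D R ^ n) ∈ opsLT S (m + n) := mul_mem_opsLT hS hT' hP
          have h5 : T' * RMero.D R ^ n ∈ opsLT S (m + n) := by
            obtain ⟨b, hb, rfl⟩ := hT'
            rw [diffOp, Finset.sum_mul]
            refine sum_mem fun j _ => ?_
            rw [mul_assoc, ← pow_add]
            exact monomial_mem_opsLT (hb j) (by omega)
          have := add_mem h4 h5
          rwa [mul_sub, sub_add_cancel] at this
        have h6 := sub_mem (sub_mem (opsLT_mono (by omega) h) h3) h2
        rwa [add_mul, add_sub_cancel_left, mul_sub, mul_assoc, sub_sub_cancel] at h6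
      rw [eq_zero_of_monomial_mem_opsLT h1, mulLeft_zero, zero_mul, add_zero] at h ⊢
      exact ih hT' h

/-- A left cofactor of a monic operator is monic if the right factor is. -/
theorem monic_of_mul_monic {n N : ℕ} {P Q : Module.End Rᵐᵒᵖ (RMero R)} [Nontrivial (RMero R)]
    (hP : P - RMero.D R ^ n ∈ opsLT S n) {m : ℕ} (hQ : Q ∈ opsLT S m)
    (h : Q * P - RMero.D R ^ N ∈ opsLT S N) : ∃ k, N = k + n ∧ Q - RMero.D R ^ k ∈ opsLT S k := by
  by_cases hN : n ≤ N
  · obtain ⟨k, rfl⟩ := Nat.exists_eq_add_of_le' hN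
    refine ⟨k, rfl, ?_⟩
    have hD : RMero.D R ^ k ∈ opsLT S (k + 1) := by
      simpa [mulLeft_one] using monomial_mem_opsLT S.one_mem (Nat.lt_succ_self k)
    refine mem_opsLT_of_mul_monic_mem hS hP (m := max m (k + 1))
      (sub_mem (opsLT_mono (le_max_left _ _) hQ) (opsLT_mono (le_max_right _ _) hD)) ?_
    have := sub_mem h (D_pow_mul_monic hS hP k)
    rwa [sub_sub_sub_cancel_right, ← sub_mul] at this
  · have h1 : RMero.D R ^ N ∈ opsLT S (N + 1) := by
      simpa [mulLeft_one] using monomial_mem_opsLT S.one_mem (Nat.lt_succ_self N)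
    have h2 : Q * P ∈ opsLT S (0 + n) := by
      have := add_mem (opsLT_mono N.le_succ h) h1
      rw [sub_add_cancel] at this
      exact opsLT_mono (by omega) this
    rw [opsLT_zero (mem_opsLT_of_mul_monic_mem hS hP hQ h2), zero_mul, zero_sub, neg_mem_iff] at h
    have h3 : mulLeft (1 : RMero R) * RMero.D R ^ N ∈ opsLT S N := by rwa [mulLeft_one, one_mul]
    exact absurd (eq_zero_of_monomial_mem_opsLT h3) one_ne_zero

end opsLT

/-! ### Rational coefficients -/

theorem Mero.aeval_X_injective : Function.Injective (Polynomial.aeval Mero.X : ℂ[X] →ₐ[ℂ] Mero) := by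
  rw [injective_iff_map_eq_zero]
  intro q hq
  by_contra h
  exact Mero.aeval_X_ne_zero h hq

/-- The embedding of the field of rational functions into meromorphic functions. -/
def Mero.ofRat : FractionRing ℂ[X] →ₐ[ℂ] Mero :=
  IsFractionRing.liftAlgHom (g := Polynomial.aeval Mero.X) Mero.aeval_X_injective

theorem Mero.ofRat_algebraMap (q : ℂ[X]) :
    Mero.ofRat (algebraMap ℂ[X] (FractionRing ℂ[X]) q) = Polynomial.aeval Mero.X q :=
  IsFractionRing.lift_algebraMap Mero.aeval_X_injective q

/-- The embedding of `R`-valued rational functions into `R`-valued meromorphic functions. -/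
def RMero.ofRat (R : Type*) [Ring R] [Algebra ℂ R] : R ⊗[ℂ] FractionRing ℂ[X] →ₐ[ℂ] RMero R :=
  Algebra.TensorProduct.map (AlgHom.id ℂ R) Mero.ofRat

theorem RMero.ofRat_injective : Function.Injective (RMero.ofRat R) :=
  Module.Flat.lTensor_preserves_injective_linearMap (M := R) Mero.ofRat.toLinearMap
    Mero.ofRat.toRingHom.injective

/-- Rational functions with values in `R` are the elements of `R ⊗ ℂ(x)`, by common denominators. -/
theorem RMero.isRational_iff_mem_range {f : RMero R} :
    f.IsRational ↔ f ∈ (RMero.ofRat R).toRingHom.range := by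
  have hX : ∀ q : ℂ[X], ((1 : R) ⊗ₜ[ℂ] (Polynomial.aeval Mero.X q : Mero)) =
      RMero.ofRat R (1 ⊗ₜ algebraMap ℂ[X] (FractionRing ℂ[X]) q) := fun q => by
    rw [RMero.ofRat, Algebra.TensorProduct.map_tmul, Mero.ofRat_algebraMap]; rfl
  constructor
  · rintro ⟨p, q, hq, h⟩
    have hp : ofPoly p ∈ (RMero.ofRat R).toRingHom.range := by
      rw [ofPoly, Polynomial.sum_def]
      refine sum_mem fun k _ => ⟨p.coeff k ⊗ₜ algebraMap ℂ[X] _ (Polynomial.X ^ k), ?_⟩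
      change RMero.ofRat R _ = _
      rw [RMero.ofRat, Algebra.TensorProduct.map_tmul, Mero.ofRat_algebraMap, map_pow,
        Polynomial.aeval_X]
      rfl
    have hq' : algebraMap ℂ[X] (FractionRing ℂ[X]) q ≠ 0 := by
      simpa using hq
    have h1 : f = RMero.ofRat R (1 ⊗ₜ (algebraMap ℂ[X] (FractionRing ℂ[X]) q)⁻¹) * ofPoly p := by
      rw [← h, hX, ← mul_assoc, ← map_mul, Algebra.TensorProduct.tmul_mul_tmul,
        inv_mul_cancel₀ hq', one_mul, ← Algebra.TensorProduct.one_def, map_one, one_mul]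
    rw [h1]
    exact mul_mem ⟨_, rfl⟩ hp
  · rintro ⟨g, rfl⟩
    change (RMero.ofRat R g).IsRational
    induction g using TensorProduct.induction_on with
    | zero => exact ⟨0, 1, one_ne_zero, by simp [ofPoly]⟩
    | add a b ha hb =>
      obtain ⟨p, q, hq, h⟩ := ha
      obtain ⟨p', q', hq', h'⟩ := hb
      refine ⟨p * q'.map (algebraMap ℂ R) + q.map (algebraMap ℂ R) * p', q * q',
        mul_ne_zero hq hq', ?_⟩
      rw [ofPoly_eq] at h h' ⊢
      rw [map_add ofPolyHom, map_mul ofPolyHom, map_mul ofPolyHom, ← h, ← h', ofPolyHom_map,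
        ofPolyHom_map, map_mul, map_add]
      have hc : ∀ g : RMero R, g * ((1 : R) ⊗ₜ[ℂ] (Polynomial.aeval Mero.X q' : Mero)) =
          (Polynomial.aeval Mero.X q' : Mero) • g := fun g => by
        rw [Algebra.smul_def]
        exact (Algebra.commutes (A := RMero R) (Polynomial.aeval Mero.X q') g).symm
      rw [hc]
      simp only [← smul_eq_tmul_mul, mul_smul, smul_add]
      rw [smul_comm]
    | tmul r c =>
      obtain ⟨p, q, hq, rfl⟩ := IsFractionRing.div_surjective (A := ℂ[X]) c
      have hq0 : q ≠ 0 := nonZeroDivisors.ne_zero hq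
      have hq' : algebraMap ℂ[X] (FractionRing ℂ[X]) q ≠ 0 := by simpa using hq0
      refine ⟨Polynomial.C r * p.map (algebraMap ℂ R), q, hq0, ?_⟩
      rw [ofPoly_eq, map_mul, ofPolyHom_map, ofPolyHom_C, hX, hX, ← map_mul,
        Algebra.TensorProduct.tmul_mul_tmul, one_mul, mul_div_cancel₀ _ hq']
      have : const r = RMero.ofRat R (r ⊗ₜ 1) := by
        rw [RMero.ofRat, Algebra.TensorProduct.map_tmul, map_one]; rfl
      rw [this, ← map_mul, Algebra.TensorProduct.tmul_mul_tmul, mul_one, one_mul]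

/-- The ring of `R`-valued rational functions. -/
def ratSubring (R : Type*) [Ring R] [Algebra ℂ R] : Subring (RMero R) :=
  (RMero.ofRat R).toRingHom.range

theorem mem_ratSubring {f : RMero R} : f ∈ ratSubring R ↔ f.IsRational :=
  isRational_iff_mem_range.symm

theorem ofPolyHom_mem_ratSubring (p : R[X]) : ofPolyHom p ∈ ratSubring R :=
  mem_ratSubring.2 ⟨p, 1, one_ne_zero, by
    rw [map_one, ← Algebra.TensorProduct.one_def, one_mul, ofPoly_eq]⟩

theorem D_mem_ratSubring (f : RMero R) (hf : f ∈ ratSubring R) : RMero.D R f ∈ ratSubring R := by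
  obtain ⟨p, q, hq, h⟩ := mem_ratSubring.1 hf
  have hq' : (Polynomial.aeval Mero.X q : Mero) ≠ 0 := Mero.aeval_X_ne_zero hq
  have hD : ∀ q : ℂ[X], ((1 : R) ⊗ₜ[ℂ] Mero.D (Polynomial.aeval Mero.X q) : RMero R) =
      ofPolyHom (q.derivative.map (algebraMap ℂ R)) := fun q => by
    rw [← D_tmul, ← ofPolyHom_map, D_ofPolyHom, Polynomial.derivative_map]
  have h1 := congrArg (RMero.D R) h
  rw [ofPoly_eq, D_ofPolyHom, RMero.D_mul, D_tmul, hD] at h1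
  have h2 : ((1 : R) ⊗ₜ[ℂ] (Polynomial.aeval Mero.X q : Mero)) * RMero.D R f ∈ ratSubring R := by
    rw [← eq_sub_iff_add_eq'] at h1
    rw [h1]
    exact sub_mem (ofPolyHom_mem_ratSubring _) (mul_mem (ofPolyHom_mem_ratSubring _) hf)
  obtain ⟨p', q', hq'', h'⟩ := mem_ratSubring.1 h2
  refine mem_ratSubring.2 ⟨p', q' * q, mul_ne_zero hq'' hq, ?_⟩
  rw [← h', map_mul, ← mul_assoc, Algebra.TensorProduct.tmul_mul_tmul, one_mul]

/-- The ring of constant functions. -/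
def constSubring (R : Type*) [Ring R] [Algebra ℂ R] : Subring (RMero R) :=
  (Algebra.TensorProduct.includeLeftRingHom : R →+* RMero R).range

theorem const_mem_constSubring (r : R) : const r ∈ constSubring R := ⟨r, rfl⟩

theorem D_mem_constSubring (f : RMero R) (hf : f ∈ constSubring R) :
    RMero.D R f ∈ constSubring R := by
  obtain ⟨r, rfl⟩ := hf
  change RMero.D R (const r) ∈ _
  rw [D_const]
  exact zero_mem _

theorem constSubring_le_ratSubring : constSubring R ≤ ratSubring R := by
  rintro _ ⟨r, rfl⟩
  have h := ofPolyHom_mem_ratSubring (Polynomial.C r)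
  rwa [ofPolyHom_C] at h

theorem isMonicRationalOp_iff {n : ℕ} {P : Module.End Rᵐᵒᵖ (RMero R)} :
    IsMonicRationalOp n P ↔ P - RMero.D R ^ n ∈ opsLT (ratSubring R) n := by
  simp only [IsMonicRationalOp, ← mem_ratSubring, ← sub_eq_iff_eq_add']
  rfl

theorem isRationalOp_iff {T : Module.End Rᵐᵒᵖ (RMero R)} :
    IsRationalOp T ↔ ∃ n, T ∈ opsLT (ratSubring R) n := by
  simp only [IsRationalOp, ← mem_ratSubring]
  rfl

theorem isMonicConstOp_iff {n : ℕ} {P : Module.End Rᵐᵒᵖ (RMero R)} :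
    IsMonicConstOp n P ↔ P - RMero.D R ^ n ∈ opsLT (constSubring R) n := by
  have : ∀ f : RMero R, f.IsConst ↔ f ∈ constSubring R := fun f =>
    ⟨fun ⟨r, hr⟩ => ⟨r, hr.symm⟩, fun ⟨r, hr⟩ => ⟨r, hr.symm⟩⟩
  simp only [IsMonicConstOp, this, ← sub_eq_iff_eq_add']
  rfl

theorem smul_eq_mulLeft_mul (c : ℂ) (T : Module.End Rᵐᵒᵖ (RMero R)) :
    c • T = mulLeft (const (algebraMap ℂ R c)) * T :=
  LinearMap.ext fun f => Algebra.smul_def c (T f)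

theorem isMonicConstOp_aeval_D {χ : ℂ[X]} (hχ : χ.Monic) :
    IsMonicConstOp χ.natDegree (Polynomial.aeval (RMero.D R) χ) := by
  rw [isMonicConstOp_iff, Polynomial.aeval_eq_sum_range, Finset.sum_range_succ,
    hχ.coeff_natDegree, one_smul, add_sub_cancel_right]
  refine sum_mem fun k hk => ?_
  rw [smul_eq_mulLeft_mul]
  exact monomial_mem_opsLT (const_mem_constSubring _) (Finset.mem_range.1 hk)

/-- A monic operator with constant coefficients right-divides a monic operator with scalar constant
coefficients: the remainders of the powers of `∂` lie in a finite dimensional space. -/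
theorem exists_aeval_D_eq_mul_of_const [FiniteDimensional ℂ R] {N : ℕ}
    {L : Module.End Rᵐᵒᵖ (RMero R)} (hL : IsMonicConstOp N L) :
    ∃ (χ : ℂ[X]) (m : ℕ), χ.Monic ∧ ∃ Q ∈ opsLT (constSubring R) m,
      Polynomial.aeval (RMero.D R) χ = Q * L := by
  rw [isMonicConstOp_iff] at hL
  have h1 : ∀ k : ℕ, ∃ (Q : Module.End Rᵐᵒᵖ (RMero R)) (a : Fin N → R),
      Q ∈ opsLT (constSubring R) (k + 1) ∧
        RMero.D R ^ k = Q * L + diffOp fun j => const (a j) := by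
    intro k
    have hD : RMero.D R ^ k ∈ opsLT (constSubring R) (k + 1) := by
      simpa [mulLeft_one] using
        monomial_mem_opsLT (constSubring R).one_mem (Nat.lt_succ_self k)
    obtain ⟨Q, hQ, U, ⟨b, hb, rfl⟩, h⟩ := exists_eq_mul_add_of_monic D_mem_constSubring hL hD
    choose a ha using hb
    exact ⟨Q, a, hQ, by rw [h]; congr 2; exact funext fun j => (ha j).symm⟩
  choose Q a hQ h using h1
  have h2 : ¬ LinearIndependent ℂ a := Module.Finite.not_linearIndependent_of_infinite a
  rw [not_linearIndependent_iff] at h2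
  obtain ⟨s, g, hg, i, hi, hgi⟩ := h2
  set p : ℂ[X] := ∑ k ∈ s, Polynomial.monomial k (g k) with hp
  have hp0 : p ≠ 0 := by
    intro h0
    have := congrArg (fun q => Polynomial.coeff q i) h0
    simp [hp, Polynomial.coeff_monomial, hi, hgi] at this
  have h3 : Polynomial.aeval (RMero.D R) p = (∑ k ∈ s, g k • Q k) * L := by
    have h4 : ∑ k ∈ s, g k • diffOp (fun j => const (a k j)) = 0 := by
      refine LinearMap.ext fun f => ?_
      simp only [LinearMap.sum_apply, LinearMap.smul_apply, diffOp_apply, Finset.smul_sum]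
      rw [Finset.sum_comm]
      refine Finset.sum_eq_zero fun j _ => ?_
      have h5 : ∑ k ∈ s, g k • const (a k j) = const ((∑ k ∈ s, g k • a k) j) := by
        rw [Finset.sum_apply]
        exact (map_sum (Algebra.TensorProduct.includeLeft : R →ₐ[ℂ] RMero R)
          (fun k => g k • a k j) s).symm
      simp only [← smul_mul_assoc, ← Finset.sum_mul, h5, hg]
      rw [Pi.zero_apply, const_zero, zero_mul]
    rw [hp, map_sum, Finset.sum_mul, ← add_zero (∑ k ∈ s, (g k • Q k) * L), ← h4,
      ← Finset.sum_add_distrib]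
    refine Finset.sum_congr rfl fun k _ => ?_
    rw [Polynomial.aeval_monomial, ← Algebra.smul_def, h k, smul_add, smul_mul_assoc]
  refine ⟨p * Polynomial.C p.leadingCoeff⁻¹, s.sup id + 1,
    Polynomial.monic_mul_leadingCoeff_inv hp0, p.leadingCoeff⁻¹ • ∑ k ∈ s, g k • Q k, ?_, ?_⟩
  · rw [smul_eq_mulLeft_mul]
    refine mulLeft_mul_mem_opsLT (const_mem_constSubring _) (sum_mem fun k hk => ?_)
    rw [smul_eq_mulLeft_mul]
    exact mulLeft_mul_mem_opsLT (const_mem_constSubring _)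
      (opsLT_mono (Nat.succ_le_succ (Finset.le_sup (f := id) hk)) (hQ k))
  · rw [mul_comm, ← Polynomial.smul_eq_C_mul, map_smul, h3, smul_mul_assoc]

/-- The constant operator in the definition of `darbouxOps` may be taken to be a monic polynomial in
`∂` with complex coefficients. -/
theorem mem_darbouxOps_iff [FiniteDimensional ℂ R] {P : Module.End Rᵐᵒᵖ (RMero R)} :
    P ∈ darbouxOps R ↔ (∃ n, IsMonicRationalOp n P) ∧ ∃ (χ : ℂ[X]) (m : ℕ), χ.Monic ∧
      ∃ Q ∈ opsLT (ratSubring R) m, Polynomial.aeval (RMero.D R) χ = Q * P := by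
  refine and_congr_right fun _ => ⟨?_, ?_⟩
  · rintro ⟨N, L, Q, hL, hQ, rfl⟩
    obtain ⟨k, hQ⟩ := isRationalOp_iff.1 hQ
    obtain ⟨χ, m, hχ, Q', hQ', h⟩ := exists_aeval_D_eq_mul_of_const hL
    exact ⟨χ, m + k, hχ, Q' * Q, mul_mem_opsLT D_mem_ratSubring
      (opsLT_le_of_le constSubring_le_ratSubring _ hQ') hQ, by rw [h, mul_assoc]⟩
  · rintro ⟨χ, m, hχ, Q, hQ, h⟩
    exact ⟨_, _, Q, isMonicConstOp_aeval_D hχ, isRationalOp_iff.2 ⟨m, hQ⟩, h⟩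

/-! ### Independence of horizontal vectors in a differential module -/

/-- Horizontal vectors of a differential module over the field of meromorphic functions that are
independent over the field of constants are independent over the field of meromorphic functions. -/
theorem linearIndependent_of_horizontal {M κ : Type*} [AddCommGroup M] [Module Mero M] [Module ℂ M]
    [IsScalarTower ℂ Mero M] (nabla : M →+ M)
    (hnabla : ∀ (c : Mero) (y : M), nabla (c • y) = Mero.D c • y + c • nabla y) {f : κ → M}
    (hf : LinearIndependent ℂ f) (h0 : ∀ i, nabla (f i) = 0) : LinearIndependent Mero f := by
  classical
  rw [linearIndependent_iff']
  intro s
  induction s using Finset.induction_on with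
  | empty => simp
  | insert a s ha ih =>
    intro c hc
    have key : c a = 0 := by
      by_contra hca
      -- normalize the coefficient at `a` to be `1` and differentiate the relation
      rw [Finset.sum_insert ha] at hc
      have h1 : f a + ∑ i ∈ s, ((c a)⁻¹ * c i) • f i = 0 := by
        have := congrArg (fun y => (c a)⁻¹ • y) hc
        simpa only [smul_add, smul_smul, inv_mul_cancel₀ hca, one_smul, Finset.smul_sum,
          smul_zero] using this
      have h2 : ∑ i ∈ s, Mero.D ((c a)⁻¹ * c i) • f i = 0 := by
        have := congrArg nabla h1
        simpa only [map_add, map_sum, hnabla, h0, smul_zero, add_zero, zero_add, map_zero]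
          using this
      have h3 : ∀ i, ∃ z : ℂ, i ∈ s → (c a)⁻¹ * c i = algebraMap ℂ Mero z := fun i => by
        by_cases hi : i ∈ s
        · obtain ⟨z, hz⟩ := Mero.exists_algebraMap_of_D_eq_zero (ih _ h2 i hi)
          exact ⟨z, fun _ => hz⟩
        · exact ⟨0, fun h => absurd h hi⟩
      choose z hz using h3
      have h4 : ∑ i ∈ insert a s, (if i = a then 1 else z i) • f i = 0 := by
        rw [Finset.sum_insert ha, if_pos rfl, one_smul, ← h1]
        congr 1
        refine Finset.sum_congr rfl fun i hi => ?_
        rw [if_neg (ne_of_mem_of_not_mem hi ha), hz i hi, algebraMap_smul]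
      have h5 := linearIndependent_iff'.1 hf _ _ h4 a (Finset.mem_insert_self a s)
      rw [if_pos rfl] at h5
      exact one_ne_zero h5
    rw [Finset.sum_insert ha, key, zero_smul, zero_add] at hc
    intro i hi
    rcases Finset.mem_insert.1 hi with rfl | hi
    · exact key
    · exact ih c hc i hi

/-! ### Jets -/

/-- The vector `(f, f', …, f^(n-1))`. -/
def jet (R : Type*) [Ring R] [Algebra ℂ R] (n : ℕ) : RMero R →ₗ[Rᵐᵒᵖ] (Fin n → RMero R) :=
  LinearMap.pi fun i => RMero.D R ^ (i : ℕ)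

theorem jet_apply (n : ℕ) (f : RMero R) (i : Fin n) : jet R n f i = (RMero.D R ^ (i : ℕ)) f := rfl

/-- The connection attached to the companion matrix of `∂^n + ∑ a_k ∂^k`. It kills the jets of the
solutions of this operator. -/
def companion {n : ℕ} (a : Fin n → RMero R) : (Fin n → RMero R) →+ (Fin n → RMero R) where
  toFun y i := RMero.D R (y i) -
    if h : (i : ℕ) + 1 < n then y ⟨i + 1, h⟩ else -∑ k, a k * y k
  map_zero' := by
    funext i
    simp
  map_add' y z := by
    funext i
    simp only [Pi.add_apply, map_add]
    split_ifs
    · abel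
    · simp only [mul_add, Finset.sum_add_distrib]; abel

theorem companion_smul {n : ℕ} (a : Fin n → RMero R) (c : Mero) (y : Fin n → RMero R) :
    companion a (c • y) = Mero.D c • y + c • companion a y := by
  funext i
  simp only [companion, AddMonoidHom.coe_mk, ZeroHom.coe_mk, Pi.smul_apply, Pi.add_apply, D_smul]
  split_ifs
  · rw [smul_sub, add_sub_assoc]
  · simp only [mul_smul_comm, ← Finset.smul_sum, smul_sub, smul_neg, add_sub_assoc]

theorem companion_jet {n : ℕ} (a : Fin n → RMero R) {f : RMero R}
    (hf : (RMero.D R ^ n + diffOp a) f = 0) : companion a (jet R n f) = 0 := by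
  funext i
  simp only [companion, AddMonoidHom.coe_mk, ZeroHom.coe_mk, jet_apply, Pi.zero_apply]
  rw [← Module.End.mul_apply, ← pow_succ']
  split_ifs with h
  · exact sub_self _
  · have hi : (i : ℕ) + 1 = n := by omega
    rw [hi, sub_neg_eq_add, ← diffOp_apply]
    exact hf

theorem eq_zero_of_jet_eq_zero {n : ℕ} (a : Fin n → RMero R) {f : RMero R}
    (hf : (RMero.D R ^ n + diffOp a) f = 0) (hj : jet R n f = 0) : f = 0 := by
  rcases n with _ | n
  · simpa [diffOp] using hf
  · exact congrFun hj 0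

/-- The Wronskian lemma for systems: solutions of an equation of order `n` that are independent over
`ℂ` have jets of order `n` that are independent over the meromorphic functions. -/
theorem linearIndependent_jet {n : ℕ} (a : Fin n → RMero R) {κ : Type*} {f : κ → RMero R}
    (hf : LinearIndependent ℂ f) (h0 : ∀ j, (RMero.D R ^ n + diffOp a) (f j) = 0) :
    LinearIndependent Mero fun j => jet R n (f j) := by
  refine linearIndependent_of_horizontal (companion a) (companion_smul a) ?_
    fun j => companion_jet a (h0 j)
  refine linearIndependent_iff'.2 fun s c hc => linearIndependent_iff'.1 hf s c ?_
  refine eq_zero_of_jet_eq_zero a ?_ ?_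
  · rw [map_sum]
    exact Finset.sum_eq_zero fun j _ => by
      rw [LinearMap.map_smul_of_tower, h0 j, smul_zero]
  · rw [map_sum, ← hc]
    exact Finset.sum_congr rfl fun j _ => LinearMap.map_smul_of_tower _ _ _

/-! ### Coordinates -/

section coord

variable {ι : Type*} (r : Module.Basis ι ℂ R)

/-- The coordinates of an `R`-valued meromorphic function with respect to a basis of `R`. -/
def meroCoord (i : ι) : RMero R →ₗ[ℂ] Mero :=
  (TensorProduct.lid ℂ Mero).toLinearMap ∘ₗ LinearMap.rTensor Mero (r.coord i)

theorem meroCoord_tmul (i : ι) (s : R) (f : Mero) : meroCoord r i (s ⊗ₜ f) = r.repr s i • f := by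
  simp [meroCoord]

theorem meroCoord_smul (i : ι) (c : Mero) (f : RMero R) :
    meroCoord r i (c • f) = c * meroCoord r i f := by
  induction f using TensorProduct.induction_on with
  | zero => simp
  | add f g hf hg => rw [smul_add, map_add, hf, hg, map_add, mul_add]
  | tmul s f => rw [RMero.smul_tmul, meroCoord_tmul, meroCoord_tmul, mul_smul_comm]

theorem sum_tmul_meroCoord [Fintype ι] (f : RMero R) : ∑ i, r i ⊗ₜ meroCoord r i f = f := by
  induction f using TensorProduct.induction_on with
  | zero => simp
  | add f g hf hg =>
    simp only [map_add, TensorProduct.tmul_add, Finset.sum_add_distrib, hf, hg]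
  | tmul s f =>
    simp only [meroCoord_tmul, ← TensorProduct.smul_tmul, ← TensorProduct.sum_tmul, r.sum_repr]

/-- Coordinates on `R`-valued functions, linearly over the meromorphic functions. -/
def meroCoordEquiv [Fintype ι] : RMero R ≃ₗ[Mero] (ι → Mero) where
  toFun f i := meroCoord r i f
  map_add' f g := funext fun i => map_add _ f g
  map_smul' c f := funext fun i => meroCoord_smul r i c f
  invFun g := ∑ i, r i ⊗ₜ g i
  left_inv f := sum_tmul_meroCoord r f
  right_inv g := by
    classical
    funext i
    simp [meroCoord_tmul, Finsupp.single_apply]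

/-- Coordinates on vectors of `R`-valued functions. -/
def meroCoordPiEquiv [Fintype ι] (n : ℕ) : (Fin n → RMero R) ≃ₗ[Mero] (Fin n × ι → Mero) :=
  (LinearEquiv.piCongrRight fun _ => meroCoordEquiv r).trans
    (LinearEquiv.curry Mero Mero (Fin n) ι).symm

/-- Quasipolynomials are entire, so that they can be evaluated at every point. -/
theorem meroCoord_mem_range_ofEntire (i : ι) {f : RMero R} (hf : f ∈ quasiPolys R) :
    meroCoord r i f ∈ Mero.ofEntire.range := by
  induction hf using Submodule.iSup_induction' with
  | zero => rw [map_zero]; exact zero_mem _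
  | add x y _ _ hx hy => rw [map_add]; exact add_mem hx hy
  | mem α x hx =>
    obtain ⟨p, rfl⟩ := hx
    rw [quasiPoly, Polynomial.sum_def, map_sum]
    refine sum_mem fun k _ => ?_
    rw [meroCoord_tmul]
    refine Subalgebra.smul_mem _ (mul_mem (pow_mem ?_ k) ?_) _
    · exact ⟨⟨fun x => x, differentiable_id⟩, rfl⟩
    · exact ⟨⟨fun x => Complex.exp (α * x), by
        change Differentiable ℂ fun x => Complex.exp (α * x)
        fun_prop⟩, rfl⟩

end coord

theorem D_mem_quasiPolys {f : RMero R} (hf : f ∈ quasiPolys R) : RMero.D R f ∈ quasiPolys R := by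
  induction hf using Submodule.iSup_induction' with
  | zero => rw [map_zero]; exact zero_mem _
  | add x y _ _ hx hy => rw [map_add]; exact add_mem hx hy
  | mem α x hx =>
    obtain ⟨p, rfl⟩ := hx
    rw [D_quasiPoly]
    exact quasiPoly_mem_quasiPolys _ _

theorem D_pow_mem_quasiPolys {f : RMero R} (hf : f ∈ quasiPolys R) (k : ℕ) :
    (RMero.D R ^ k) f ∈ quasiPolys R := by
  induction k with
  | zero => exact hf
  | succ k ih =>
    rw [pow_succ', Module.End.mul_apply]
    exact D_mem_quasiPolys ih

instance [FiniteDimensional ℂ R] : Module.Finite Mero (RMero R) :=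
  Module.Finite.equiv (meroCoordEquiv (Module.finBasis ℂ R)).symm

theorem finrank_pi_rMero [FiniteDimensional ℂ R] (n : ℕ) :
    Module.finrank Mero (Fin n → RMero R) = n * Module.finrank ℂ R := by
  rw [(meroCoordPiEquiv (Module.finBasis ℂ R) n).finrank_eq]
  simp

/-- The map `r ⊗ f ↦ ev(f) r` from `R`-valued functions to `R`, for a linear functional `ev` on scalar
functions. It is linear over the right action of `R`. -/
def applyFunctional (R : Type*) [Ring R] [Algebra ℂ R] (ev : Mero →ₗ[ℂ] ℂ) :
    RMero R →ₗ[Rᵐᵒᵖ] R :=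
  (TensorProduct.AlgebraTensorModule.rid ℂ Rᵐᵒᵖ R).toLinearMap ∘ₗ
    TensorProduct.AlgebraTensorModule.map (LinearMap.id : R →ₗ[Rᵐᵒᵖ] R) ev

theorem repr_applyFunctional {ι : Type*} (r : Module.Basis ι ℂ R) (ev : Mero →ₗ[ℂ] ℂ)
    (f : RMero R) (i : ι) : r.repr (applyFunctional R ev f) i = ev (meroCoord r i f) := by
  induction f using TensorProduct.induction_on with
  | zero => simp
  | add f g hf hg => rw [map_add, map_add, map_add, map_add, Finsupp.add_apply, hf, hg]
  | tmul s f =>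
    rw [meroCoord_tmul, map_smul]
    simp [applyFunctional, mul_comm]

/-- If the jets of `n · dim R` quasipolynomials are independent over the meromorphic functions, then
their values at a suitable point are independent over `ℂ`: the determinant of the coordinates is a
nonzero entire function. The map `J` is the jet at that point, with evaluation extended to all
meromorphic functions as a linear functional. -/
theorem exists_eval_jet [FiniteDimensional ℂ R] {n : ℕ} {κ : Type*} [Fintype κ] {f : κ → RMero R}
    (hf : ∀ j, f j ∈ quasiPolys R) (hκ : Fintype.card κ = n * Module.finrank ℂ R)
    (hli : LinearIndependent Mero fun j => jet R n (f j)) :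
    ∃ J : RMero R →ₗ[Rᵐᵒᵖ] (Fin n → R), LinearIndependent ℂ fun j => J (f j) := by
  classical
  let r := Module.finBasis ℂ R
  let ι := Fin n × Fin (Module.finrank ℂ R)
  have hcard : Fintype.card ι = Fintype.card κ := by simp [ι, hκ]
  let e : ι ≃ κ := Fintype.equivOfCardEq hcard
  have hent : ∀ (j p : ι), ∃ g : Mero.Entire,
      Mero.ofEntire g = meroCoord r p.2 (jet R n (f (e j)) p.1) := fun j p =>
    meroCoord_mem_range_ofEntire r p.2 (D_pow_mem_quasiPolys (hf (e j)) _)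
  choose g hg using hent
  let H : Matrix ι ι Mero.Entire := Matrix.of g
  have hrows : LinearIndependent Mero (H.map Mero.ofEntire).row := by
    have h1 := (hli.comp e e.injective).map' (meroCoordPiEquiv r n).toLinearMap
      (LinearEquiv.ker _)
    have h2 : (H.map Mero.ofEntire).row =
        (meroCoordPiEquiv r n).toLinearMap ∘ (fun j => jet R n (f j)) ∘ e :=
      funext fun j => funext fun p => hg j p
    rw [h2]
    exact h1
  have hdet : H.det ≠ 0 := by
    intro h0
    have h1 := (Matrix.isUnit_iff_isUnit_det _).1 (Matrix.linearIndependent_rows_iff_isUnit.1 hrows)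
    have h2 : (H.map Mero.ofEntire).det = Mero.ofEntire H.det :=
      (AlgHom.map_det Mero.ofEntire H).symm
    rw [h2, h0, map_zero] at h1
    exact not_isUnit_zero h1
  obtain ⟨x, hx⟩ : ∃ x, (H.det : ℂ → ℂ) x ≠ 0 := by
    by_contra! h
    exact hdet (Subtype.ext (funext h))
  obtain ⟨ev, hev⟩ := Mero.exists_eval x
  let φ : Mero.Entire →ₐ[ℂ] ℂ := (Pi.evalAlgHom ℂ (fun _ : ℂ => ℂ) x).comp Mero.Entire.val
  have hdet' : IsUnit (H.map φ).det := by
    have h1 : (H.map φ).det = φ H.det := (AlgHom.map_det φ H).symm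
    rw [h1]
    exact IsUnit.mk0 _ hx
  have hrows' : LinearIndependent ℂ (H.map φ).row :=
    Matrix.linearIndependent_rows_iff_isUnit.2 ((Matrix.isUnit_iff_isUnit_det _).2 hdet')
  refine ⟨LinearMap.pi fun i => applyFunctional R ev ∘ₗ RMero.D R ^ (i : ℕ), ?_⟩
  rw [← linearIndependent_equiv e]
  let coords : (Fin n → R) →ₗ[ℂ] (ι → ℂ) :=
    LinearMap.pi fun p => r.coord p.2 ∘ₗ LinearMap.proj p.1
  refine LinearIndependent.of_comp coords ?_
  have h3 : (H.map φ).row = coords ∘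
      ((fun j => (LinearMap.pi fun i => applyFunctional R ev ∘ₗ RMero.D R ^ (i : ℕ) :
        RMero R →ₗ[Rᵐᵒᵖ] (Fin n → R)) (f j)) ∘ e) := by
    funext j p
    change (g j p : ℂ → ℂ) x = r.repr (applyFunctional R ev ((RMero.D R ^ (p.1 : ℕ)) (f (e j)))) p.2
    rw [repr_applyFunctional, ← jet_apply n (f (e j)) p.1, ← hg, hev]
  rw [← h3]
  exact hrows'

/-! ### Kernels of the right divisors of constant operators -/

/-- An operator of order `n` has at most `n · dim R` independent solutions. -/
theorem finrank_le_of_monic [FiniteDimensional ℂ R] {n : ℕ} {P : Module.End Rᵐᵒᵖ (RMero R)} (hP : IsMonicRationalOp n P)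
    (U : Submodule ℂ (RMero R)) [FiniteDimensional ℂ U] (hU : ∀ f ∈ U, P f = 0) :
    Module.finrank ℂ U ≤ n * Module.finrank ℂ R := by
  obtain ⟨a, -, rfl⟩ := hP
  let b := Module.finBasis ℂ U
  have h1 : LinearIndependent ℂ fun j => (b j : RMero R) :=
    b.linearIndependent.map' U.subtype (Submodule.ker_subtype U)
  have h2 := (linearIndependent_jet a h1 fun j => hU _ (b j).2).fintype_card_le_finrank
  rwa [Fintype.card_fin, finrank_pi_rMero] at h2

theorem ker_le_ker_of_eq_mul {L Q P : Module.End Rᵐᵒᵖ (RMero R)} (h : L = Q * P) :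
    LinearMap.ker P ≤ LinearMap.ker L := fun f hf => by
  rw [LinearMap.mem_ker, h, Module.End.mul_apply, LinearMap.mem_ker.1 hf, map_zero]

theorem ker_le_quasiPolys [FiniteDimensional ℂ R] {P : Module.End Rᵐᵒᵖ (RMero R)} (hP : P ∈ darbouxOps R) :
    LinearMap.ker P ≤ quasiPolys R := by
  obtain ⟨-, χ, m, hχ, Q, -, h⟩ := mem_darbouxOps_iff.1 hP
  exact (ker_le_ker_of_eq_mul h).trans (ker_aeval_D_le_quasiPolys hχ)

theorem finiteDimensional_ker [FiniteDimensional ℂ R] {P : Module.End Rᵐᵒᵖ (RMero R)} (hP : P ∈ darbouxOps R) :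
    FiniteDimensional ℂ (LinearMap.ker P) := by
  obtain ⟨-, χ, m, hχ, Q, -, h⟩ := mem_darbouxOps_iff.1 hP
  have : FiniteDimensional ℂ ((LinearMap.ker (Polynomial.aeval (RMero.D R) χ)).restrictScalars ℂ) :=
    finiteDimensional_ker_aeval_D (R := R) hχ
  exact Submodule.finiteDimensional_of_le
    (S₁ := (LinearMap.ker P).restrictScalars ℂ)
    (S₂ := (LinearMap.ker (Polynomial.aeval (RMero.D R) χ)).restrictScalars ℂ)
    (ker_le_ker_of_eq_mul h)

/-- The kernel of a right divisor of order `n` of a constant operator has the largest possible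
dimension: `P` maps the kernel of the constant operator into that of the monic quotient. -/
theorem finrank_ker [FiniteDimensional ℂ R] {n : ℕ} {P : Module.End Rᵐᵒᵖ (RMero R)} (hn : IsMonicRationalOp n P)
    (hP : P ∈ darbouxOps R) :
    Module.finrank ℂ (LinearMap.ker P) = n * Module.finrank ℂ R := by
  have hfin := finiteDimensional_ker hP
  have hfin' : FiniteDimensional ℂ ((LinearMap.ker P).restrictScalars ℂ) := hfin
  refine le_antisymm (finrank_le_of_monic hn ((LinearMap.ker P).restrictScalars ℂ) fun f hf => hf) ?_
  rcases subsingleton_or_nontrivial R with hR | hR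
  · rw [Module.finrank_zero_of_subsingleton, mul_zero]
    exact Nat.zero_le _
  have : Nontrivial (RMero R) := const_injective.nontrivial
  obtain ⟨-, χ, m, hχ, Q, hQ, h⟩ := mem_darbouxOps_iff.1 hP
  have hχ' := opsLT_le_of_le (constSubring_le_ratSubring (R := R)) _
    (isMonicConstOp_iff.1 (isMonicConstOp_aeval_D hχ))
  rw [h] at hχ'
  obtain ⟨k, hk, hQk⟩ := monic_of_mul_monic D_mem_ratSubring (isMonicRationalOp_iff.1 hn) hQ hχ'
  have hfinχ := finiteDimensional_ker_aeval_D (R := R) hχ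
  let X := (LinearMap.ker (Polynomial.aeval (RMero.D R) χ)).restrictScalars ℂ
  have : FiniteDimensional ℂ X := hfinχ
  let φ : X →ₗ[ℂ] RMero R := (P.restrictScalars ℂ) ∘ₗ X.subtype
  have h1 := LinearMap.finrank_range_add_finrank_ker φ
  have h2 : Module.finrank ℂ (LinearMap.range φ) ≤ k * Module.finrank ℂ R := by
    refine finrank_le_of_monic (isMonicRationalOp_iff.2 hQk) _ ?_
    rintro _ ⟨⟨f, hf⟩, rfl⟩
    have hf' : Polynomial.aeval (RMero.D R) χ f = 0 := hf
    rwa [h] at hf'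
  have h3 : Module.finrank ℂ (LinearMap.ker φ) ≤ Module.finrank ℂ (LinearMap.ker P) := by
    let ψ : LinearMap.ker φ →ₗ[ℂ] LinearMap.ker P :=
      { toFun := fun f => ⟨f.1.1, f.2⟩
        map_add' := fun _ _ => rfl
        map_smul' := fun _ _ => rfl }
    exact LinearMap.finrank_le_finrank_of_injective (f := ψ) fun f g hfg =>
      by
      have h4 : (f.1.1 : RMero R) = g.1.1 := congrArg (fun x : LinearMap.ker P => x.1) hfg
      exact Subtype.ext (Subtype.ext h4)
  have h4 : Module.finrank ℂ X = χ.natDegree * Module.finrank ℂ R := finrank_ker_aeval_D hχ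
  rw [h4, hk, add_mul] at h1
  omega

theorem linearIndependent_jet_ker {n : ℕ} {P : Module.End Rᵐᵒᵖ (RMero R)}
    (hn : IsMonicRationalOp n P) {κ : Type*} {f : κ → RMero R} (hf : LinearIndependent ℂ f)
    (h0 : ∀ j, f j ∈ LinearMap.ker P) : LinearIndependent Mero fun j => jet R n (f j) := by
  obtain ⟨a, -, rfl⟩ := hn
  exact linearIndependent_jet a hf h0

theorem span_jet_ker [FiniteDimensional ℂ R] {n : ℕ} {P : Module.End Rᵐᵒᵖ (RMero R)} (hn : IsMonicRationalOp n P)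
    (hP : P ∈ darbouxOps R) :
    Submodule.span Mero (jet R n '' (LinearMap.ker P : Set (RMero R))) = ⊤ := by
  have hfin := finiteDimensional_ker hP
  let b := Module.finBasis ℂ (LinearMap.ker P)
  have h1 : LinearIndependent ℂ fun j => (b j : RMero R) :=
    b.linearIndependent.map' ((LinearMap.ker P).subtype.restrictScalars ℂ)
      (LinearMap.ker_eq_bot.2 Subtype.val_injective)
  have h2 := linearIndependent_jet_ker hn h1 fun j => (b j).2
  rw [eq_top_iff, ← h2.span_eq_top_of_card_eq_finrank'
    (by rw [Fintype.card_fin, finrank_pi_rMero, finrank_ker hn hP])]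
  refine Submodule.span_mono ?_
  rintro _ ⟨j, rfl⟩
  exact ⟨_, (b j).2, rfl⟩

/-- At a suitable point the jets identify the kernel with `R^n`. -/
theorem exists_jet_bijective [FiniteDimensional ℂ R] {n : ℕ} {P : Module.End Rᵐᵒᵖ (RMero R)} (hn : IsMonicRationalOp n P)
    (hP : P ∈ darbouxOps R) : ∃ J : RMero R →ₗ[Rᵐᵒᵖ] (Fin n → R),
      Function.Bijective (J.domRestrict (LinearMap.ker P)) := by
  have hfin := finiteDimensional_ker hP
  have hrank := finrank_ker hn hP
  let b := Module.finBasis ℂ (LinearMap.ker P)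
  have h1 : LinearIndependent ℂ fun j => (b j : RMero R) :=
    b.linearIndependent.map' ((LinearMap.ker P).subtype.restrictScalars ℂ)
      (LinearMap.ker_eq_bot.2 Subtype.val_injective)
  obtain ⟨J, hJ⟩ := exists_eval_jet (n := n) (fun j => ker_le_quasiPolys hP (b j).2)
    (by rw [Fintype.card_fin, hrank]) (linearIndependent_jet_ker hn h1 fun j => (b j).2)
  refine ⟨J, ?_⟩
  let φ : LinearMap.ker P →ₗ[ℂ] (Fin n → R) := (J.domRestrict (LinearMap.ker P)).restrictScalars ℂ
  have hdim : Module.finrank ℂ (LinearMap.ker P) = Module.finrank ℂ (Fin n → R) := by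
    rw [hrank, Module.finrank_pi_fintype, Finset.sum_const, Finset.card_univ, Fintype.card_fin,
      smul_eq_mul]
  have hsurj : Function.Surjective φ := by
    rw [← LinearMap.range_eq_top, eq_top_iff, ← hJ.span_eq_top_of_card_eq_finrank'
      (by rw [Fintype.card_fin, hdim]), Submodule.span_le]
    rintro _ ⟨j, rfl⟩
    exact ⟨b j, rfl⟩
  exact ⟨(LinearMap.injective_iff_surjective_of_finrank_eq_finrank hdim).2 hsurj, hsurj⟩

/-! ### Wronski matrices -/

theorem wronskiMatrix_mulVec_const {l : ℕ} (F : Fin l → RMero R) (s : Fin l → R) :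
    wronskiMatrix F *ᵥ (fun j => const (s j)) = jet R l (∑ j, MulOpposite.op (s j) • F j) := by
  funext i
  rw [jet_apply, map_sum]
  change ∑ j, (RMero.D R ^ (i : ℕ)) (F j) * const (s j) = _
  refine Finset.sum_congr rfl fun j _ => ?_
  rw [map_smul, op_smul_eq_mul_const]

/-- With its converse `isUnit_wronskiMatrix_of_span_jet`, this expresses invertibility of a Wronski
matrix by the module alone: the jets of its elements span all vectors of functions. -/
theorem span_jet_of_isUnit_wronskiMatrix {l : ℕ} {F : Fin l → RMero R}
    {V : Submodule Rᵐᵒᵖ (RMero R)} (hF : ∀ j, F j ∈ V) (hW : IsUnit (wronskiMatrix F)) :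
    Submodule.span Mero (jet R l '' (V : Set (RMero R))) = ⊤ := by
  rw [eq_top_iff]
  rintro v -
  obtain ⟨W', hW'⟩ := hW.exists_right_inv
  have h1 : v = wronskiMatrix F *ᵥ (W' *ᵥ v) := by
    rw [Matrix.mulVec_mulVec, hW', Matrix.one_mulVec]
  have h2 : ∀ (j : Fin l) (g : RMero R), (fun i : Fin l => (RMero.D R ^ (i : ℕ)) (F j) * g) ∈
      Submodule.span Mero (jet R l '' (V : Set (RMero R))) := by
    intro j g
    induction g using TensorProduct.induction_on with
    | zero =>
      simp only [mul_zero]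
      exact zero_mem _
    | add g h hg hh =>
      simp only [mul_add]
      exact add_mem hg hh
    | tmul r c =>
      have h3 : (fun i : Fin l => (RMero.D R ^ (i : ℕ)) (F j) * (r ⊗ₜ c)) =
          c • jet R l (MulOpposite.op r • F j) := by
        funext i
        have h4 : (r ⊗ₜ c : RMero R) = c • const r := by rw [const, RMero.smul_tmul, mul_one]
        rw [Pi.smul_apply, jet_apply, map_smul, op_smul_eq_mul_const, h4, mul_smul_comm]
      rw [h3]
      exact Submodule.smul_mem _ _ (Submodule.subset_span ⟨_, V.smul_mem _ (hF j), rfl⟩)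
  have h3 : wronskiMatrix F *ᵥ (W' *ᵥ v) =
      ∑ j, fun i : Fin l => (RMero.D R ^ (i : ℕ)) (F j) * (W' *ᵥ v) j := by
    funext i
    rw [Finset.sum_apply]
    rfl
  rw [h1, h3]
  exact sum_mem fun j _ => h2 j _

theorem isUnit_wronskiMatrix_of_span_jet [FiniteDimensional ℂ R] {l : ℕ} {F : Fin l → RMero R}
    {V : Submodule Rᵐᵒᵖ (RMero R)} (hF : V ≤ Submodule.span Rᵐᵒᵖ (Set.range F))
    (hV : Submodule.span Mero (jet R l '' (V : Set (RMero R))) = ⊤) :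
    IsUnit (wronskiMatrix F) := by
  have hnoeth : IsNoetherianRing (RMero R) :=
    isNoetherian_of_tower Mero (inferInstance : IsNoetherian Mero (RMero R))
  have h1 : ∀ v : Fin l → RMero R, ∃ u, wronskiMatrix F *ᵥ u = v := by
    intro v
    have hv : v ∈ Submodule.span Mero (jet R l '' (V : Set (RMero R))) := hV ▸ Submodule.mem_top
    induction hv using Submodule.span_induction with
    | mem x hx =>
      obtain ⟨f, hf, rfl⟩ := hx
      obtain ⟨c, rfl⟩ := (Submodule.mem_span_range_iff_exists_fun Rᵐᵒᵖ).1 (hF hf)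
      exact ⟨_, wronskiMatrix_mulVec_const F fun j => (c j).unop⟩
    | zero => exact ⟨0, Matrix.mulVec_zero _⟩
    | add x y _ _ hx hy =>
      obtain ⟨u, rfl⟩ := hx
      obtain ⟨w, rfl⟩ := hy
      exact ⟨u + w, Matrix.mulVec_add _ _ _⟩
    | smul c x _ hx =>
      obtain ⟨u, rfl⟩ := hx
      exact ⟨c • u, Matrix.mulVec_smul _ _ _⟩
  choose u hu using fun j => h1 (Pi.single j 1)
  refine IsUnit.of_mul_eq_one (Matrix.of fun i j => u j i) ?_
  ext i j
  have h2 := congrFun (hu j) i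
  rw [Matrix.one_apply]
  refine h2.trans ?_
  rw [Pi.single_apply]

/-- An operator of order less than `n` that kills `n` functions with invertible Wronski matrix
vanishes. -/
theorem diffOp_eq_zero_of_isUnit_wronskiMatrix {n : ℕ} {F : Fin n → RMero R}
    (hW : IsUnit (wronskiMatrix F)) {a : Fin n → RMero R} (h : ∀ j, diffOp a (F j) = 0) : a = 0 := by
  have h1 : Matrix.vecMul a (wronskiMatrix F) = 0 := by
    funext j
    rw [Pi.zero_apply, ← h j, diffOp_apply]
    rfl
  obtain ⟨W', hW'⟩ := hW.exists_right_inv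
  rw [← Matrix.vecMul_one a, ← hW', ← Matrix.vecMul_vecMul, h1, Matrix.zero_vecMul]

theorem eq_of_isMonicRationalOp {n : ℕ} {F : Fin n → RMero R}
    (hW : IsUnit (wronskiMatrix F)) {P P' : Module.End Rᵐᵒᵖ (RMero R)}
    (hP : IsMonicRationalOp n P) (hP' : IsMonicRationalOp n P') (h : ∀ j, P (F j) = 0)
    (h' : ∀ j, P' (F j) = 0) : P = P' := by
  obtain ⟨a, -, rfl⟩ := hP
  obtain ⟨b, -, rfl⟩ := hP'
  have h1 : a + -b = 0 := by
    refine diffOp_eq_zero_of_isUnit_wronskiMatrix hW fun j => ?_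
    have h2 := (h j).trans (h' j).symm
    rw [LinearMap.add_apply, LinearMap.add_apply, add_right_inj] at h2
    rw [diffOp_add, diffOp_neg, LinearMap.add_apply, LinearMap.neg_apply, h2, add_neg_cancel]
  rw [add_neg_eq_zero.1 h1]

/-! ### Kernels are graded by the exponents -/

theorem ofPolyHom_mul_mem_expComponent (p : R[X]) {α : ℂ} {f : RMero R}
    (hf : f ∈ expComponent R α) : ofPolyHom p * f ∈ expComponent R α := by
  obtain ⟨q, rfl⟩ := hf
  exact ⟨p * q, by rw [quasiPoly_eq, quasiPoly_eq, map_mul, mul_smul_comm]⟩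

theorem D_pow_mem_expComponent {α : ℂ} {f : RMero R} (hf : f ∈ expComponent R α) (k : ℕ) :
    (RMero.D R ^ k) f ∈ expComponent R α := by
  induction k with
  | zero => exact hf
  | succ k ih =>
    rw [pow_succ', Module.End.mul_apply]
    obtain ⟨p, hp⟩ := ih
    rw [hp, D_quasiPoly]
    exact quasiPoly_mem_expComponent _ _

theorem exists_common_denominator {κ : Type*} (s : Finset κ) (a : κ → RMero R)
    (ha : ∀ k, a k ∈ ratSubring R) : ∃ q : ℂ[X], q ≠ 0 ∧ ∀ k ∈ s, ∃ p : R[X],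
      (Polynomial.aeval Mero.X q : Mero) • a k = ofPolyHom p := by
  classical
  induction s using Finset.induction_on with
  | empty => exact ⟨1, one_ne_zero, by simp⟩
  | insert j s hj ih =>
    obtain ⟨q, hq, h⟩ := ih
    obtain ⟨p, q', hq', h'⟩ := mem_ratSubring.1 (ha j)
    rw [ofPoly_eq, ← RMero.smul_eq_tmul_mul] at h'
    have hmap : ∀ (q : ℂ[X]) (p : R[X]), (Polynomial.aeval Mero.X q : Mero) • ofPolyHom p =
        ofPolyHom (q.map (algebraMap ℂ R) * p) := fun q p => by
      rw [map_mul, ofPolyHom_map, RMero.smul_eq_tmul_mul]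
    refine ⟨q * q', mul_ne_zero hq hq', fun k hk => ?_⟩
    rcases Finset.mem_insert.1 hk with rfl | hk
    · exact ⟨_, by rw [map_mul, mul_smul, h', hmap]⟩
    · obtain ⟨p', hp'⟩ := h k hk
      exact ⟨_, by rw [mul_comm, map_mul, mul_smul, hp', hmap]⟩

/-- An operator with rational coefficients maps `R[x] exp (α x)` to rational multiples of
`exp (α x)`, so it annihilates a quasipolynomial only together with all of its components. -/
theorem isGradedByExponents_ker {n : ℕ} {P : Module.End Rᵐᵒᵖ (RMero R)}
    (hn : IsMonicRationalOp n P) (hle : LinearMap.ker P ≤ quasiPolys R) :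
    IsGradedByExponents (LinearMap.ker P) := by
  classical
  refine ⟨iSupIndep_expComponent.mono fun α => inf_le_right, le_antisymm ?_
    (iSup_le fun α => inf_le_left)⟩
  intro f hf
  obtain ⟨F, hF, hsum⟩ := (Submodule.mem_iSup_iff_exists_finsupp _ _).1 (hle hf)
  obtain ⟨a, ha, rfl⟩ := hn
  obtain ⟨q, hq, h⟩ := exists_common_denominator Finset.univ a fun k => mem_ratSubring.2 (ha k)
  set c : Mero := Polynomial.aeval Mero.X q
  have hc : c ≠ 0 := Mero.aeval_X_ne_zero hq
  -- after clearing denominators the operator preserves every component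
  have hcomp : ∀ α, ∀ g ∈ expComponent R α,
      c • (RMero.D R ^ n + diffOp a) g ∈ expComponent R α := by
    intro α g hg
    rw [LinearMap.add_apply, diffOp_apply, smul_add, Finset.smul_sum]
    refine add_mem ?_ (sum_mem fun k _ => ?_)
    · rw [RMero.smul_eq_tmul_mul, ← ofPolyHom_map]
      exact ofPolyHom_mul_mem_expComponent _ (D_pow_mem_expComponent hg n)
    · obtain ⟨p, hp⟩ := h k (Finset.mem_univ k)
      rw [← smul_mul_assoc, hp]
      exact ofPolyHom_mul_mem_expComponent _ (D_pow_mem_expComponent hg k)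
  have hzero : ∑ α ∈ F.support, c • (RMero.D R ^ n + diffOp a) (F α) = 0 := by
    rw [← Finset.smul_sum, ← map_sum]
    change c • (RMero.D R ^ n + diffOp a) (F.sum fun _ x => x) = 0
    rw [hsum, LinearMap.mem_ker.1 hf, smul_zero]
  have hker : ∀ α ∈ F.support, (RMero.D R ^ n + diffOp a) (F α) = 0 := fun α hα =>
    (smul_eq_zero.1 ((iSupIndep_iff_finsetSum_eq_zero_imp_eq_zero _).1 iSupIndep_expComponent
      F.support (fun α => c • (RMero.D R ^ n + diffOp a) (F α))
      (fun α _ => hcomp α _ (hF α)) hzero α hα)).resolve_left hc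
  rw [← hsum]
  exact sum_mem fun α hα => Submodule.mem_iSup_of_mem α ⟨hker α hα, hF α⟩

/-! ### The exchange argument -/

/-- Replacing a basis vector by a vector whose coordinate there is a unit gives a basis. -/
theorem Module.Basis.exists_update {A N ι : Type*} [Ring A] [AddCommGroup N] [Module A N] [Fintype ι]
    [DecidableEq ι] (b : Module.Basis ι A N) (j : ι) (y : N) (hu : IsUnit (b.repr y j)) :
    ∃ b' : Module.Basis ι A N, ⇑b' = Function.update b j y := by
  have hli : LinearIndependent A (Function.update b j y) := by
    rw [Fintype.linearIndependent_iff]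
    intro g hg
    have h1 : g j • y + ∑ i ∈ Finset.univ.erase j, g i • b i = 0 := by
      rw [← Finset.add_sum_erase _ _ (Finset.mem_univ j), Function.update_self] at hg
      rw [← hg]
      congr 1
      refine Finset.sum_congr rfl fun i hi => ?_
      rw [Function.update_of_ne (Finset.ne_of_mem_erase hi)]
    have hj : g j = 0 := by
      have h2 := congrArg (fun x => b.repr x j) h1
      simp only [map_add, map_smul, map_sum, Finsupp.add_apply, Finsupp.smul_apply,
        Finsupp.finsetSum_apply, map_zero, Finsupp.zero_apply, b.repr_self] at h2
      rw [Finset.sum_eq_zero, add_zero, smul_eq_mul] at h2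
      · exact hu.mul_left_eq_zero.1 h2
      · intro i hi
        rw [Finsupp.single_eq_of_ne (Finset.ne_of_mem_erase hi).symm, smul_zero]
    rw [hj, zero_smul, zero_add] at h1
    have h3 := Fintype.linearIndependent_iff.1 b.linearIndependent (Function.update g j 0) (by
      rw [← Finset.add_sum_erase _ _ (Finset.mem_univ j), Function.update_self, zero_smul,
        zero_add, ← h1]
      refine Finset.sum_congr rfl fun i hi => ?_
      rw [Function.update_of_ne (Finset.ne_of_mem_erase hi)])
    intro i
    by_cases hi : i = j
    · rw [hi, hj]
    · simpa [Function.update_of_ne hi] using h3 i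
  refine ⟨Module.Basis.mk hli ?_, Module.Basis.coe_mk _ _⟩
  have hmem : ∀ i, i ≠ j → b i ∈ Submodule.span A (Set.range (Function.update b j y)) :=
    fun i hi => Submodule.subset_span ⟨i, Function.update_of_ne hi _ _⟩
  have hj : b j ∈ Submodule.span A (Set.range (Function.update b j y)) := by
    have h1 := b.sum_repr y
    rw [← Finset.add_sum_erase _ _ (Finset.mem_univ j)] at h1
    obtain ⟨v, hv⟩ := hu.exists_left_inv
    have h2 : b j = v • (y - ∑ i ∈ Finset.univ.erase j, b.repr y i • b i) := by
      rw [← eq_sub_iff_add_eq] at h1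
      rw [← h1, smul_smul, hv, one_smul]
    rw [h2]
    refine Submodule.smul_mem _ _ (sub_mem (Submodule.subset_span ⟨j, Function.update_self _ _ _⟩)
      (sum_mem fun i hi => Submodule.smul_mem _ _ (hmem i (Finset.ne_of_mem_erase hi))))
  rw [← b.span_eq, Submodule.span_le]
  rintro _ ⟨i, rfl⟩
  by_cases hi : i = j
  · exact hi ▸ hj
  · exact hmem i hi

section primitive

variable [FiniteDimensional ℂ R] {e : R}

/-- Fitting's lemma in the corner `eRe` of a primitive idempotent: the minimal polynomial of `a`,
split into its part at `0` and the rest, yields two orthogonal idempotents with sum `e`. -/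
theorem isNilpotent_or_exists_mul_eq (he : IsIdempotentElem e)
    (hprim : ∀ f g : R, IsIdempotentElem f → IsIdempotentElem g → f * g = 0 → g * f = 0 →
      e = f + g → f = 0 ∨ g = 0) {a : R} (h1 : e * a = a) (h2 : a * e = a) :
    IsNilpotent a ∨ ∃ x, x * a = e := by
  have hint : IsIntegral ℂ a := Algebra.IsIntegral.isIntegral a
  obtain ⟨q, hq, hq0⟩ := Polynomial.exists_eq_pow_rootMultiplicity_mul_and_not_dvd
    (minpoly ℂ a) (minpoly.ne_zero hint) 0
  set k := (minpoly ℂ a).rootMultiplicity 0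
  rw [map_zero, sub_zero] at hq hq0
  have hco : IsCoprime (Polynomial.X ^ (k + 1) : ℂ[X]) q :=
    IsCoprime.pow_left ((Polynomial.irreducible_X.coprime_iff_not_dvd).2 hq0)
  obtain ⟨u, v, huv⟩ := hco
  have hzero : Polynomial.aeval a (q * Polynomial.X ^ (k + 1)) = 0 := by
    rw [pow_succ, ← mul_assoc, mul_comm q, ← hq, map_mul, minpoly.aeval, zero_mul]
  -- the exponent is `k + 1` so that `a` can be split off also when `a` is invertible
  set s := Polynomial.aeval a (u * Polynomial.X ^ (k + 1)) with hs
  set t := Polynomial.aeval a (v * q) with ht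
  have hst : s + t = 1 := by rw [hs, ht, ← map_add, huv, map_one]
  have hmul : s * t = 0 := by
    rw [hs, ht, ← map_mul, show u * Polynomial.X ^ (k + 1) * (v * q) =
      (u * v) * (q * Polynomial.X ^ (k + 1)) by ring, map_mul, hzero, mul_zero]
  have hmul' : t * s = 0 := by
    rw [hs, ht, ← map_mul, mul_comm, map_mul]
    exact hmul
  have hcomm : ∀ p : ℂ[X], Commute e (Polynomial.aeval a p) := fun p =>
    (Polynomial.aeval_eq_sum_range (R := ℂ) (p := p) a) ▸
      Commute.sum_right _ _ _ fun i _ =>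
        ((show Commute e a from h1.trans h2.symm).pow_right i).smul_right _
  have hss : s * s = s := by rw [← add_zero (s * s), ← hmul, ← mul_add, hst, mul_one]
  have htt : t * t = t := by rw [← zero_add (t * t), ← hmul, ← add_mul, hst, one_mul]
  have hes : e * s = s * e := hcomm _
  have het : e * t = t * e := hcomm _
  have key := hprim (e * s) (e * t)
    (by rw [IsIdempotentElem, mul_assoc, ← mul_assoc s, ← hes, mul_assoc e s s, hss, ← mul_assoc,
      he.eq])
    (by rw [IsIdempotentElem, mul_assoc, ← mul_assoc t, ← het, mul_assoc e t t, htt, ← mul_assoc,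
      he.eq])
    (by rw [mul_assoc, ← mul_assoc s, ← hes, mul_assoc e s t, hmul, mul_zero, mul_zero])
    (by rw [mul_assoc, ← mul_assoc t, ← het, mul_assoc e t s, hmul', mul_zero, mul_zero])
    (by rw [← mul_add, hst, mul_one])
  rcases key with key | key
  · left
    refine ⟨k + 1, ?_⟩
    have h3 : e * t = e := by
      rw [← mul_one e, ← hst, mul_assoc, add_mul, hmul, zero_add, htt, mul_add, key, zero_add]
    have h4 : t * a ^ (k + 1) = 0 := by
      have : t * a ^ (k + 1) = Polynomial.aeval a (v * (q * Polynomial.X ^ (k + 1))) := by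
        rw [← mul_assoc, map_mul, map_pow, Polynomial.aeval_X]
      rw [this, map_mul, hzero, mul_zero]
    have h5 : a ^ (k + 1) = e * a ^ (k + 1) := by rw [pow_succ', ← mul_assoc, h1]
    rw [h5, ← h3, mul_assoc, h4, mul_zero]
  · right
    refine ⟨e * Polynomial.aeval a (u * Polynomial.X ^ k), ?_⟩
    have h3 : Polynomial.aeval a (u * Polynomial.X ^ k) * a = s := by
      rw [hs, pow_succ, ← mul_assoc, map_mul _ _ Polynomial.X, Polynomial.aeval_X]
    rw [mul_assoc, h3, ← add_zero (e * s), ← key, ← mul_add, hst, mul_one]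

/-- The corner of a primitive idempotent is a local ring: if a sum of its elements has a left inverse
in it, so has one of the summands. For `e = 0`, which is allowed, there need not be any summand. -/
theorem exists_mul_eq_of_sum (he : IsIdempotentElem e)
    (hprim : ∀ f g : R, IsIdempotentElem f → IsIdempotentElem g → f * g = 0 → g * f = 0 →
      e = f + g → f = 0 ∨ g = 0) {ι : Type*} (s : Finset ι) (a : ι → R)
    (h2 : ∀ i, a i * e = a i) (x : R) (hx : x * ∑ i ∈ s, a i = e) :
    e = 0 ∨ ∃ i ∈ s, ∃ y, y * a i = e := by
  classical
  induction s using Finset.induction_on generalizing x with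
  | empty => left; simpa using hx.symm
  | insert j s hj ih =>
    rw [Finset.sum_insert hj] at hx
    set b := ∑ i ∈ s, a i
    have hx' : e * x * a j + e * x * b = e := by
      rw [← mul_add, mul_assoc, hx, he.eq]
    rcases isNilpotent_or_exists_mul_eq he hprim (a := e * x * a j)
      (by rw [← mul_assoc, ← mul_assoc, he.eq]) (by rw [mul_assoc, h2]) with h | ⟨y, hy⟩
    · obtain ⟨k, hk⟩ := h
      have h3 : (1 - e * x * a j) * e = e * x * b := by
        rw [sub_mul, one_mul, mul_assoc (e * x), h2, sub_eq_iff_eq_add', hx']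
      have h4 : ((∑ i ∈ Finset.range k, (e * x * a j) ^ i) * (e * x)) * b = e := by
        rw [mul_assoc, ← h3, ← mul_assoc, geom_sum_mul_neg, hk, sub_zero, one_mul]
      rcases ih _ h4 with h | ⟨i, hi, h⟩
      · exact Or.inl h
      · exact Or.inr ⟨i, Finset.mem_insert_of_mem hi, h⟩
    · exact Or.inr ⟨j, Finset.mem_insert_self j s, y * (e * x), by rw [mul_assoc, hy]⟩

/-- The local property of a primitive idempotent, in the form used for exchanging summands. -/
theorem exists_isUnit_of_sum_eq (he : IsIdempotentElem e)
    (hprim : ∀ f g : R, IsIdempotentElem f → IsIdempotentElem g → f * g = 0 → g * f = 0 →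
      e = f + g → f = 0 ∨ g = 0) {ι : Type*} (s : Finset ι) (c : ι → R) (hc : ∀ i, c i * e = c i)
    (hsum : ∑ i ∈ s, c i = e) : e = 0 ∨ ∃ i ∈ s, IsUnit (1 - e + c i) := by
  have hnoeth : IsNoetherianRing R :=
    isNoetherian_of_tower ℂ (inferInstance : IsNoetherian ℂ R)
  rcases exists_mul_eq_of_sum he hprim s (fun i => e * c i)
    (fun i => by rw [mul_assoc, hc]) e
    (by rw [← Finset.mul_sum, hsum, he.eq, he.eq]) with h | ⟨i, hi, y, hy⟩
  · exact Or.inl h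
  · refine Or.inr ⟨i, hi, ?_⟩
    -- up to a factor `1 + n` with `n ^ 2 = 0`, the element `1 - e + y e` is a left inverse
    have h1 : (1 - e + y * e) * (1 - e + c i) = 1 + (1 - e) * c i := by
      have h2 : y * e * c i = e := by rw [mul_assoc, hy]
      have h3 : (1 - e) * (1 - e) = 1 - e := he.one_sub.eq
      have h4 : y * e * (1 - e) = 0 := by rw [mul_assoc, mul_sub, mul_one, he.eq, sub_self, mul_zero]
      rw [add_mul, mul_add, mul_add, h2, h3, h4]
      abel
    have h2 : (1 - (1 - e) * c i) * (1 + (1 - e) * c i) = 1 := by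
      have h3 : (1 - e) * c i * ((1 - e) * c i) = 0 := by
        rw [mul_assoc, ← mul_assoc (c i), mul_sub, mul_one, hc, sub_self, zero_mul, mul_zero]
      rw [sub_mul, one_mul, mul_add, mul_one, h3]
      abel
    rw [← h1, ← mul_assoc] at h2
    exact IsUnit.of_mul_eq_one_right _ h2

end primitive

/-- If a free right module is the sum of submodules `W i`, then every basis can be changed into one
whose pieces `b_j e_k` lie in the `W i`: exchange the summands `b_j e_k R` one at a time. -/
theorem exists_basis_op_smul_mem [FiniteDimensional ℂ R] {m : ℕ} {e : Fin m → R}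
    (he : IsPrimitiveSystem e) {N : Type*} [AddCommGroup N] [Module Rᵐᵒᵖ N] {l : ℕ}
    (b : Module.Basis (Fin l) Rᵐᵒᵖ N) {I : Type*} [Nonempty I] (W : I → Submodule Rᵐᵒᵖ N)
    (hW : ⨆ i, W i = ⊤) : ∃ b' : Module.Basis (Fin l) Rᵐᵒᵖ N,
      ∀ j k, ∃ i, MulOpposite.op (e k) • b' j ∈ W i := by
  classical
  have key : ∀ T : Finset (Fin l × Fin m), ∃ b' : Module.Basis (Fin l) Rᵐᵒᵖ N,
      ∀ t ∈ T, ∃ i, MulOpposite.op (e t.2) • b' t.1 ∈ W i := by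
    intro T
    induction T using Finset.induction_on with
    | empty => exact ⟨b, by simp⟩
    | insert t T ht ih =>
      obtain ⟨b, hb⟩ := ih
      obtain ⟨j, k⟩ := t
      have hidem := he.complete.idem k
      obtain ⟨i, w, hw, hu⟩ : ∃ i, ∃ w ∈ W i,
          IsUnit (1 - e k + (b.repr (MulOpposite.op (e k) • w) j).unop) := by
        have h1 : MulOpposite.op (e k) • b j ∈ ⨆ i, W i := hW ▸ Submodule.mem_top
        obtain ⟨w, hw, hsum⟩ := (Submodule.mem_iSup_iff_exists_finsupp _ _).1 h1
        rcases exists_isUnit_of_sum_eq hidem (he.primitive k) w.support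
          (fun i => (b.repr (MulOpposite.op (e k) • w i) j).unop)
          (fun i => by
            rw [map_smul, Finsupp.smul_apply, smul_eq_mul, MulOpposite.unop_mul,
              MulOpposite.unop_op, mul_assoc, hidem.eq])
          -- the coordinates of the pieces `w i e_k` at `j` add up to that of `b_j e_k`, which is `e_k`
          (by
            have h2 : MulOpposite.op (e k) • ∑ i ∈ w.support, w i = MulOpposite.op (e k) • b j := by
              change MulOpposite.op (e k) • (w.sum fun _ x => x) = _
              rw [hsum, smul_smul, ← MulOpposite.op_mul, hidem.eq]
            have h3 := congrArg (fun x => (b.repr x j).unop) h2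
            simpa [Finset.smul_sum] using h3) with h | ⟨i, -, hi⟩
        · exact ⟨Classical.arbitrary I, 0, zero_mem _, by simp [h]⟩
        · exact ⟨i, w i, hw i, hi⟩
      -- replace the piece `b_j e_k` by `w e_k` and keep the pieces `b_j e_i` with `i ≠ k`
      set y := b j - MulOpposite.op (e k) • b j + MulOpposite.op (e k) • w with hy
      have hyj : IsUnit (b.repr y j) := by
        have h1 : b.repr y j =
            MulOpposite.op (1 - e k + (b.repr (MulOpposite.op (e k) • w) j).unop) := by
          rw [hy, map_add, map_sub, map_smul, b.repr_self]
          simp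
        rw [h1]
        exact hu.op
      obtain ⟨b', hb'⟩ := b.exists_update j y hyj
      refine ⟨b', ?_⟩
      have hyk : MulOpposite.op (e k) • y = MulOpposite.op (e k) • w := by
        rw [hy, smul_add, smul_sub, smul_smul, smul_smul, ← MulOpposite.op_mul, hidem.eq, sub_self,
          zero_add]
      have hyi : ∀ i, i ≠ k → MulOpposite.op (e i) • y = MulOpposite.op (e i) • b j := by
        intro i hi
        have h1 : e k * e i = 0 := he.complete.ortho hi.symm
        rw [hy, smul_add, smul_sub, smul_smul, smul_smul, ← MulOpposite.op_mul, h1,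
          MulOpposite.op_zero, zero_smul, zero_smul, sub_zero, add_zero]
      rintro ⟨j', k'⟩ h
      rw [hb']
      by_cases hj : j' = j
      · subst hj
        rw [Function.update_self]
        by_cases hk : k' = k
        · subst hk
          exact ⟨i, by rw [hyk]; exact (W i).smul_mem _ hw⟩
        · rw [hyi k' hk]
          refine hb (j', k') ((Finset.mem_insert.1 h).resolve_left fun h' => hk ?_)
          exact congrArg Prod.snd h'
      · rw [Function.update_of_ne hj]
        refine hb (j', k') ((Finset.mem_insert.1 h).resolve_left fun h' => hj ?_)
        exact congrArg Prod.fst h'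
  obtain ⟨b', hb'⟩ := key Finset.univ
  exact ⟨b', fun j k => hb' (j, k) (Finset.mem_univ _)⟩

/-! ### The three descriptions of modules of adelic type -/

theorem sum_op_smul {A : Type*} [Ring A] {m : ℕ} {e : Fin m → A}
    (he : IsPrimitiveSystem e) {N : Type*} [AddCommGroup N] [Module Aᵐᵒᵖ N] (x : N) :
    ∑ k, MulOpposite.op (e k) • x = x := by
  rw [← Finset.sum_smul, ← Finset.op_sum, he.complete.complete, MulOpposite.op_one, one_smul]

theorem op_smul_sum_op_smul {A : Type*} [Ring A] {m : ℕ} {e : Fin m → A}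
    (he : IsPrimitiveSystem e) {N : Type*} [AddCommGroup N] [Module Aᵐᵒᵖ N] (x : Fin m → N) (k : Fin m) :
    MulOpposite.op (e k) • ∑ i, MulOpposite.op (e i) • x i = MulOpposite.op (e k) • x k := by
  rw [Finset.smul_sum, Finset.sum_eq_single k]
  · rw [smul_smul, ← MulOpposite.op_mul, (he.complete.idem k).eq]
  · intro i _ hi
    rw [smul_smul, ← MulOpposite.op_mul, he.complete.ortho hi, MulOpposite.op_zero, zero_smul]
  · exact fun h => absurd (Finset.mem_univ k) h

variable {m : ℕ} {e : Fin m → R}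

/-- If `b_j` is a basis of the first type, then `V` is the direct sum of the modules `b_j e_k R`. -/
theorem HasAdelicBasis.hasCyclicDecomposition (he : IsPrimitiveSystem e)
    {V : Submodule Rᵐᵒᵖ (RMero R)} (h : HasAdelicBasis e V) : HasCyclicDecomposition e V := by
  obtain ⟨l, b, p, α, hb⟩ := h
  have hpiece : ∀ j k, MulOpposite.op (e k) • quasiPoly (p j k) (α j k) =
      MulOpposite.op (e k) • (b j : RMero R) := fun j k => by
    rw [hb, op_smul_sum_op_smul he]
  let σ : Fin (l * m) ≃ Fin l × Fin m := finProdFinEquiv.symm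
  refine ⟨l * m, fun t => p (σ t).1 (σ t).2, fun t => α (σ t).1 (σ t).2, fun t => (σ t).2, ?_, ?_⟩
  · have hind : iSupIndep fun t : Fin l × Fin m =>
        Submodule.span Rᵐᵒᵖ {MulOpposite.op (e t.2) • quasiPoly (p t.1 t.2) (α t.1 t.2)} := by
      classical
      rw [iSupIndep_iff_finsetSum_eq_zero_imp_eq_zero]
      intro s v hv hsum t ht
      have hc : ∀ t, ∃ c : R, t ∈ s → v t = MulOpposite.op (e t.2 * c) • (b t.1 : RMero R) := by
        intro t
        by_cases ht : t ∈ s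
        · obtain ⟨c, hc⟩ := Submodule.mem_span_singleton.1 (hv t ht)
          refine ⟨c.unop, fun _ => ?_⟩
          rw [← hc, hpiece, smul_smul, MulOpposite.op_mul, MulOpposite.op_unop]
        · exact ⟨0, fun h => absurd h ht⟩
      choose c hc using hc
      let d : Fin l → Fin m → R := fun j k => if (j, k) ∈ s then c (j, k) else 0
      have h1 : ∑ j, MulOpposite.op (∑ k, e k * d j k) • b j = 0 := by
        refine Subtype.ext ?_
        rw [Submodule.coe_sum, Submodule.coe_zero, ← hsum]
        simp only [Submodule.coe_sum, Submodule.coe_smul, Finset.op_sum, Finset.sum_smul]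
        rw [← Fintype.sum_prod_type' fun j k => MulOpposite.op (e k * d j k) • (b j : RMero R),
          ← Finset.univ_inter s, ← Finset.sum_ite_mem]
        refine Finset.sum_congr rfl fun t _ => ?_
        by_cases ht : t ∈ s
        · rw [if_pos ht, hc t ht]
          simp [d, ht]
        · rw [if_neg ht]
          simp [d, ht]
      have h2 := Fintype.linearIndependent_iff.1 b.linearIndependent _ h1 t.1
      have h3 : e t.2 * d t.1 t.2 = 0 := by
        have h4 := congrArg (fun x => e t.2 * x) (MulOpposite.op_injective h2)
        simp only [mul_zero, Finset.mul_sum] at h4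
        rw [Finset.sum_eq_single t.2 (fun k _ hk => by
          rw [← mul_assoc, he.complete.ortho hk.symm, zero_mul]) (by simp), ← mul_assoc,
          (he.complete.idem t.2).eq] at h4
        exact h4
      have h5 : d t.1 t.2 = c t := if_pos ht
      rw [hc t ht, ← h5, h3, MulOpposite.op_zero, zero_smul]
    exact hind.comp σ.injective
  · rw [σ.iSup_comp (g := fun t : Fin l × Fin m =>
        Submodule.span Rᵐᵒᵖ {MulOpposite.op (e t.2) • quasiPoly (p t.1 t.2) (α t.1 t.2)})]
    refine le_antisymm ?_ (iSup_le fun t => ?_)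
    · intro f hf
      have h1 : f = ∑ j, (b.repr ⟨f, hf⟩ j) • (b j : RMero R) := by
        have h2 := congrArg Subtype.val (b.sum_repr ⟨f, hf⟩)
        rw [Submodule.coe_sum] at h2
        exact h2.symm
      rw [h1]
      refine sum_mem fun j _ => Submodule.smul_mem _ _ ?_
      rw [hb]
      exact sum_mem fun k _ => Submodule.mem_iSup_of_mem (j, k)
        (Submodule.mem_span_singleton_self _)
    · rw [Submodule.span_singleton_le_iff_mem, hpiece]
      exact V.smul_mem _ (b t.1).2

theorem HasCyclicDecomposition.isGradedByExponents {V : Submodule Rᵐᵒᵖ (RMero R)}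
    (h : HasCyclicDecomposition e V) : IsGradedByExponents V := by
  obtain ⟨n, p, α, i, -, hV⟩ := h
  refine ⟨iSupIndep_expComponent.mono fun α => inf_le_right,
    le_antisymm ?_ (iSup_le fun α => inf_le_left)⟩
  conv_lhs => rw [hV]
  refine iSup_le fun k => le_trans (le_inf ?_ ?_) (le_iSup (fun β => V ⊓ expComponent R β) (α k))
  · rw [hV]
    exact le_iSup (fun k => Submodule.span Rᵐᵒᵖ
      {MulOpposite.op (e (i k)) • quasiPoly (p k) (α k)}) k
  · rw [Submodule.span_singleton_le_iff_mem]
    exact Submodule.smul_mem _ _ (quasiPoly_mem_expComponent _ _)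

/-- The exchange argument starts from any basis of `V` and uses only that `V` is the sum of its
homogeneous parts. -/
theorem IsGradedByExponents.hasAdelicBasis [FiniteDimensional ℂ R] (he : IsPrimitiveSystem e)
    {V : Submodule Rᵐᵒᵖ (RMero R)} (hV : IsGradedByExponents V) {l : ℕ} (hl : IsFreeOfRank V l) :
    HasAdelicBasis e V := by
  obtain ⟨b⟩ := hl
  have hsup : ⨆ α : ℂ, (expComponent R α).comap V.subtype = ⊤ := by
    rw [eq_top_iff]
    rintro ⟨f, hf⟩ -
    have h1 := hf
    rw [hV.2] at h1
    obtain ⟨F, hF, hsum⟩ := (Submodule.mem_iSup_iff_exists_finsupp _ _).1 h1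
    have h2 : (⟨f, hf⟩ : V) = ∑ α ∈ F.support, ⟨F α, (hF α).1⟩ := by
      refine Subtype.ext ?_
      rw [Submodule.coe_sum]
      exact hsum.symm
    rw [h2]
    exact sum_mem fun α _ => Submodule.mem_iSup_of_mem α (hF α).2
  obtain ⟨b', hb'⟩ := exists_basis_op_smul_mem he b _ hsup
  choose α hα using hb'
  choose p hp using hα
  refine ⟨l, b', p, α, fun j => ?_⟩
  rw [← sum_op_smul he (b' j : RMero R)]
  refine Finset.sum_congr rfl fun k _ => ?_
  rw [← hp j k]
  change _ = MulOpposite.op (e k) • MulOpposite.op (e k) • (b' j : RMero R)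
  rw [smul_smul, ← MulOpposite.op_mul, (he.complete.idem k).eq]

/-! ### The operator of a module of adelic type -/

instance [FiniteDimensional ℂ R] :
    Module.Finite (FractionRing ℂ[X]) (R ⊗[ℂ] FractionRing ℂ[X]) :=
  Module.Finite.equiv
    (Algebra.TensorProduct.commRight ℂ (FractionRing ℂ[X]) R).toLinearEquiv

/-- An invertible matrix of meromorphic functions whose entries are rational has a rational
inverse: matrices of rational functions form a finite dimensional algebra over the field of scalar
rational functions, where elements that are not zero divisors are invertible. -/
theorem exists_rational_left_inverse [FiniteDimensional ℂ R] {l : ℕ}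
    {W : Matrix (Fin l) (Fin l) (RMero R)} (hW : IsUnit W) (hrat : ∀ i j, W i j ∈ ratSubring R) :
    ∃ W' : Matrix (Fin l) (Fin l) (RMero R), (∀ i j, W' i j ∈ ratSubring R) ∧ W' * W = 1 := by
  let φ : Matrix (Fin l) (Fin l) (R ⊗[ℂ] FractionRing ℂ[X]) →+* Matrix (Fin l) (Fin l) (RMero R) :=
    (RMero.ofRat R).toRingHom.mapMatrix
  have hφ : Function.Injective φ := fun A B h => by
    ext i j
    exact ofRat_injective (congrFun (congrFun h i) j)
  choose w hw using hrat
  have hwW : φ (Matrix.of w) = W := by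
    ext i j
    exact hw i j
  have htower : IsScalarTower (FractionRing ℂ[X])
      (Matrix (Fin l) (Fin l) (R ⊗[ℂ] FractionRing ℂ[X]))
      (Matrix (Fin l) (Fin l) (R ⊗[ℂ] FractionRing ℂ[X])) := ⟨fun c A B => Matrix.smul_mul c A B⟩
  have hart : IsArtinianRing (Matrix (Fin l) (Fin l) (R ⊗[ℂ] FractionRing ℂ[X])) :=
    isArtinian_of_tower (FractionRing ℂ[X]) (inferInstance :
      IsArtinian (FractionRing ℂ[X]) (Matrix (Fin l) (Fin l) (R ⊗[ℂ] FractionRing ℂ[X])))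
  have hreg : IsRegular (Matrix.of w) := by
    constructor
    · intro A B h
      refine hφ (hW.isRegular.left ?_)
      have h1 := congrArg φ h
      simpa only [map_mul, hwW] using h1
    · intro A B h
      refine hφ (hW.isRegular.right ?_)
      have h1 := congrArg φ h
      simpa only [map_mul, hwW] using h1
  obtain ⟨w', hw'⟩ := (IsArtinianRing.isUnit_iff_isRegular.2 hreg).exists_left_inv
  refine ⟨φ w', fun i j => ⟨w' i j, rfl⟩, ?_⟩
  rw [← hwW, ← map_mul, hw', map_one]

variable {m : ℕ} {e : Fin m → R}

/-- The exponential factor `∑_k exp (α_k x) e_k`. -/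
def expFactor (e : Fin m → R) (α : Fin m → ℂ) : RMero R := ∑ k, e k ⊗ₜ Mero.exp (α k)

theorem expFactor_mul_expFactor_neg (he : IsPrimitiveSystem e) (α : Fin m → ℂ) :
    expFactor e α * expFactor e (-α) = 1 := by
  rw [expFactor, expFactor, Finset.sum_mul]
  have h1 : ∀ k, e k ⊗ₜ[ℂ] Mero.exp (α k) * ∑ i, e i ⊗ₜ[ℂ] Mero.exp ((-α) i) = const (e k) := by
    intro k
    rw [Finset.mul_sum, Finset.sum_eq_single k]
    · rw [Algebra.TensorProduct.tmul_mul_tmul, (he.complete.idem k).eq, Pi.neg_apply,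
        Mero.exp_mul_exp_neg]
      rfl
    · intro i _ hi
      rw [Algebra.TensorProduct.tmul_mul_tmul, he.complete.ortho hi.symm, TensorProduct.zero_tmul]
    · exact fun h => absurd (Finset.mem_univ k) h
  simp only [h1]
  rw [← const_one, ← he.complete.complete]
  exact (map_sum (Algebra.TensorProduct.includeLeft : R →ₐ[ℂ] RMero R) e Finset.univ).symm

/-- The factor `expFactor e α` does not depend on `k`, which makes it common to all terms of an
element of adelic type. -/
theorem op_smul_quasiPoly_eq (he : IsPrimitiveSystem e) (p : R[X]) (α : Fin m → ℂ) (k : Fin m) :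
    MulOpposite.op (e k) • quasiPoly p (α k) =
      ofPolyHom (p * Polynomial.C (e k)) * expFactor e α := by
  have h1 : const (e k) * expFactor e α = Mero.exp (α k) • const (e k) := by
    rw [expFactor, Finset.mul_sum, Finset.sum_eq_single k]
    · rw [const, Algebra.TensorProduct.tmul_mul_tmul, (he.complete.idem k).eq, one_mul,
        RMero.smul_tmul, mul_one]
    · intro i _ hi
      rw [const, Algebra.TensorProduct.tmul_mul_tmul, he.complete.ortho hi.symm,
        TensorProduct.zero_tmul]
    · exact fun h => absurd (Finset.mem_univ k) h
  rw [op_smul_eq_mul_const, quasiPoly_eq, map_mul, ofPolyHom_C, mul_assoc, h1, mul_smul_comm,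
    smul_mul_assoc]

/-- All derivatives of an element of adelic type have the same exponential factor, on the right. -/
theorem exists_D_pow_eq_ofPolyHom_mul (he : IsPrimitiveSystem e) (p : Fin m → R[X])
    (α : Fin m → ℂ) (i : ℕ) : ∃ g : R[X],
      (RMero.D R ^ i) (∑ k, MulOpposite.op (e k) • quasiPoly (p k) (α k)) =
        ofPolyHom g * expFactor e α := by
  induction i generalizing p with
  | zero =>
    refine ⟨∑ k, p k * Polynomial.C (e k), ?_⟩
    rw [pow_zero, Module.End.one_apply, map_sum, Finset.sum_mul]
    exact Finset.sum_congr rfl fun k _ => op_smul_quasiPoly_eq he (p k) α k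
  | succ i ih =>
    obtain ⟨g, hg⟩ := ih fun k => Polynomial.derivative (p k) + α k • p k
    refine ⟨g, ?_⟩
    rw [← hg, pow_succ, Module.End.mul_apply, map_sum]
    simp only [map_smul, D_quasiPoly]

/-- The operator that kills a nondegenerate family of adelic type has rational coefficients, since
the exponential factors of the columns of the Wronski matrix cancel. -/
theorem exists_isMonicRationalOp_of_isUnit_wronskiMatrix [FiniteDimensional ℂ R]
    (he : IsPrimitiveSystem e) {l : ℕ} (p : Fin l → Fin m → R[X]) (α : Fin l → Fin m → ℂ)
    {F : Fin l → RMero R} (hF : ∀ j, F j = ∑ k, MulOpposite.op (e k) • quasiPoly (p j k) (α j k))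
    (hW : IsUnit (wronskiMatrix F)) :
    ∃ P : Module.End Rᵐᵒᵖ (RMero R), IsMonicRationalOp l P ∧ ∀ j, P (F j) = 0 := by
  have h1 : ∀ (i : ℕ) (j : Fin l), ∃ g : R[X],
      (RMero.D R ^ i) (F j) = ofPolyHom g * expFactor e (α j) := fun i j => by
    rw [hF]
    exact exists_D_pow_eq_ofPolyHom_mul he (p j) (α j) i
  choose g hg using h1
  let W₀ : Matrix (Fin l) (Fin l) (RMero R) := Matrix.of fun i j => ofPolyHom (g i j)
  let E : Matrix (Fin l) (Fin l) (RMero R) := Matrix.diagonal fun j => expFactor e (α j)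
  let E' : Matrix (Fin l) (Fin l) (RMero R) := Matrix.diagonal fun j => expFactor e (-α j)
  have hE : E * E' = 1 := by
    rw [Matrix.diagonal_mul_diagonal, ← Matrix.diagonal_one]
    congr 1
    exact funext fun j => expFactor_mul_expFactor_neg he (α j)
  have hE' : E' * E = 1 := by
    rw [Matrix.diagonal_mul_diagonal, ← Matrix.diagonal_one]
    congr 1
    funext j
    simpa using expFactor_mul_expFactor_neg he (-α j)
  have hWE : wronskiMatrix F = W₀ * E := by
    ext i j
    rw [Matrix.mul_diagonal]
    exact hg i j
  have hW₀ : IsUnit W₀ := by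
    have h2 : W₀ = wronskiMatrix F * E' := by rw [hWE, mul_assoc, hE, mul_one]
    rw [h2]
    exact hW.mul (isUnit_iff_exists.2 ⟨E, hE', hE⟩)
  obtain ⟨W', hrat, hW'⟩ := exists_rational_left_inverse hW₀ fun i j =>
    ofPolyHom_mem_ratSubring (g i j)
  let q : Fin l → RMero R := fun j => ofPolyHom (g l j)
  let a : Fin l → RMero R := -(Matrix.vecMul q W')
  have ha : ∀ k, a k ∈ ratSubring R := fun k => by
    change -(∑ j, q j * W' j k) ∈ ratSubring R
    exact neg_mem (sum_mem fun j _ => mul_mem (ofPolyHom_mem_ratSubring _) (hrat j k))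
  refine ⟨RMero.D R ^ l + diffOp a, ⟨a, fun k => mem_ratSubring.1 (ha k), rfl⟩, fun j => ?_⟩
  have h2 : Matrix.vecMul a W₀ = -q := by
    rw [Matrix.neg_vecMul, Matrix.vecMul_vecMul, hW', Matrix.vecMul_one]
  have h3 : diffOp a (F j) = Matrix.vecMul a W₀ j * expFactor e (α j) := by
    rw [diffOp_apply, Matrix.vecMul, dotProduct, Finset.sum_mul]
    refine Finset.sum_congr rfl fun k _ => ?_
    rw [hg, ← mul_assoc]
    rfl
  rw [LinearMap.add_apply, h3, h2, hg, Pi.neg_apply, neg_mul, add_neg_cancel]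

/-- A monic scalar polynomial in `∂` kills the given quasipolynomials; dividing it on the right by
`P` leaves a remainder of order less than `l` that kills them too, hence is zero. -/
theorem mem_darbouxOps_of_isUnit_wronskiMatrix [FiniteDimensional ℂ R] {l : ℕ}
    {F : Fin l → RMero R} (hW : IsUnit (wronskiMatrix F)) (hF : ∀ j, F j ∈ quasiPolys R)
    {P : Module.End Rᵐᵒᵖ (RMero R)} (hP : IsMonicRationalOp l P) (hPF : ∀ j, P (F j) = 0) :
    P ∈ darbouxOps R := by
  choose χ hχ hχF using fun j => exists_aeval_D_eq_zero (hF j)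
  have hmonic : (∏ j, χ j).Monic := Polynomial.monic_prod_of_monic _ _ fun j _ => hχ j
  have hkill : ∀ j, Polynomial.aeval (RMero.D R) (∏ j, χ j) (F j) = 0 := fun j => by
    rw [← Finset.prod_erase_mul _ _ (Finset.mem_univ j), map_mul, Module.End.mul_apply, hχF,
      map_zero]
  have hT : Polynomial.aeval (RMero.D R) (∏ j, χ j) ∈
      opsLT (ratSubring R) ((∏ j, χ j).natDegree + 1) := by
    rw [Polynomial.aeval_eq_sum_range]
    refine sum_mem fun k hk => ?_
    rw [smul_eq_mulLeft_mul]
    exact monomial_mem_opsLT (constSubring_le_ratSubring (const_mem_constSubring _))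
      (Finset.mem_range.1 hk)
  obtain ⟨Q, hQ, U, ⟨u, hu, rfl⟩, h⟩ :=
    exists_eq_mul_add_of_monic D_mem_ratSubring (isMonicRationalOp_iff.1 hP) hT
  refine mem_darbouxOps_iff.2 ⟨⟨l, hP⟩, _, _, hmonic, Q, hQ, ?_⟩
  have hu0 : u = 0 := diffOp_eq_zero_of_isUnit_wronskiMatrix hW fun j => by
    have h1 := hkill j
    rwa [h, LinearMap.add_apply, Module.End.mul_apply, hPF, map_zero, zero_add] at h1
  rw [h, hu0, diffOp_zero, add_zero]

theorem finrank_of_isFreeOfRank [FiniteDimensional ℂ R] {V : Submodule Rᵐᵒᵖ (RMero R)} {l : ℕ}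
    (h : IsFreeOfRank V l) :
    Module.Finite ℂ V ∧ Module.finrank ℂ V = l * Module.finrank ℂ R := by
  obtain ⟨b⟩ := h
  have hfin : Module.Finite ℂ Rᵐᵒᵖ := Module.Finite.equiv (MulOpposite.opLinearEquiv ℂ)
  let ψ : V ≃ₗ[ℂ] (Fin l → Rᵐᵒᵖ) := b.equivFun.restrictScalars ℂ
  refine ⟨Module.Finite.equiv ψ.symm, ?_⟩
  rw [ψ.finrank_eq, Module.finrank_pi_fintype, Finset.sum_const, Finset.card_univ,
    Fintype.card_fin, smul_eq_mul, ← (MulOpposite.opLinearEquiv ℂ (M := R)).finrank_eq]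

theorem eq_of_isFreeOfRank [FiniteDimensional ℂ R] [Nontrivial R] {V : Submodule Rᵐᵒᵖ (RMero R)}
    {l l' : ℕ} (h : IsFreeOfRank V l) (h' : IsFreeOfRank V l') : l = l' :=
  Nat.eq_of_mul_eq_mul_right Module.finrank_pos
    ((finrank_of_isFreeOfRank h).2.symm.trans (finrank_of_isFreeOfRank h').2)

theorem le_span_range_coe_basis {V : Submodule Rᵐᵒᵖ (RMero R)} {l : ℕ}
    (b : Module.Basis (Fin l) Rᵐᵒᵖ V) :
    V ≤ Submodule.span Rᵐᵒᵖ (Set.range fun j => (b j : RMero R)) := by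
  intro f hf
  have h2 := congrArg Subtype.val (b.sum_repr ⟨f, hf⟩)
  rw [Submodule.coe_sum] at h2
  change _ = f at h2
  rw [← h2]
  exact sum_mem fun j _ => Submodule.smul_mem _ _ (Submodule.subset_span ⟨j, rfl⟩)

/-- For modules of adelic type the basis of adelic type has an invertible Wronski matrix. -/
theorem exists_adelic_family [FiniteDimensional ℂ R] {V : Submodule Rᵐᵒᵖ (RMero R)}
    (hV : V ∈ adelicModules e) {l : ℕ} (hl : IsFreeOfRank V l) :
    ∃ (F : Fin l → RMero R) (p : Fin l → Fin m → R[X]) (α : Fin l → Fin m → ℂ),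
      (∀ j, F j ∈ V) ∧ V ≤ Submodule.span Rᵐᵒᵖ (Set.range F) ∧ IsUnit (wronskiMatrix F) ∧
      ∀ j, F j = ∑ k, MulOpposite.op (e k) • quasiPoly (p j k) (α j k) := by
  obtain ⟨-, ⟨l₁, b₁, hW⟩, l₂, b₂, p, α, hb₂⟩ := hV
  -- over the zero ring the rank is not determined by the module, but every family will do
  rcases subsingleton_or_nontrivial R with hR | hR
  · have : Subsingleton (RMero R) := Algebra.TensorProduct.includeLeftRingHom.codomain_trivial
      (α := R)
    exact ⟨0, 0, 0, fun _ => zero_mem _, fun f _ => by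
      rw [Subsingleton.elim f 0]; exact zero_mem _, isUnit_of_subsingleton _,
      fun _ => Subsingleton.elim _ _⟩
  · obtain rfl := eq_of_isFreeOfRank hl ⟨b₁⟩
    obtain rfl := eq_of_isFreeOfRank hl ⟨b₂⟩
    have hspan := span_jet_of_isUnit_wronskiMatrix (fun j => (b₁ j).2) hW
    exact ⟨fun j => b₂ j, p, α, fun j => (b₂ j).2, le_span_range_coe_basis b₂,
      isUnit_wronskiMatrix_of_span_jet (le_span_range_coe_basis b₂) hspan, hb₂⟩

/-- Every module of adelic type and rank `l` is the kernel of an operator of order `l`: it lies in the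
kernel of the operator built from its Wronski matrix, and the dimensions agree. -/
theorem exists_mem_darbouxOps_ker_eq [FiniteDimensional ℂ R] (he : IsPrimitiveSystem e)
    {V : Submodule Rᵐᵒᵖ (RMero R)} (hV : V ∈ adelicModules e) {l : ℕ} (hl : IsFreeOfRank V l) :
    ∃ P ∈ darbouxOps R, IsMonicRationalOp l P ∧ LinearMap.ker P = V := by
  obtain ⟨F, p, α, hFV, hspan, hW, hF⟩ := exists_adelic_family hV hl
  obtain ⟨P, hP, hPF⟩ := exists_isMonicRationalOp_of_isUnit_wronskiMatrix he p α hF hW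
  have hdar := mem_darbouxOps_of_isUnit_wronskiMatrix hW (fun j => hV.1 (hFV j)) hP hPF
  refine ⟨P, hdar, hP, ?_⟩
  have hle : V ≤ LinearMap.ker P := hspan.trans (Submodule.span_le.2 (by
    rintro _ ⟨j, rfl⟩
    exact hPF j))
  have hfin : FiniteDimensional ℂ ((LinearMap.ker P).restrictScalars ℂ) :=
    finiteDimensional_ker hdar
  have h1 : V.restrictScalars ℂ = (LinearMap.ker P).restrictScalars ℂ :=
    Submodule.eq_of_le_of_finrank_eq hle
      ((finrank_of_isFreeOfRank hl).2.trans (finrank_ker hP hdar).symm)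
  exact (Submodule.restrictScalars_injective ℂ _ _ h1).symm

/-! ### The kernel as a right module -/

/-- The kernel of an operator of order `n` in `darbouxOps R` is free of rank `n`: the jet at a
suitable point identifies it with `R^n`. -/
theorem exists_basis_ker [FiniteDimensional ℂ R] {n : ℕ} {P : Module.End Rᵐᵒᵖ (RMero R)}
    (hn : IsMonicRationalOp n P) (hP : P ∈ darbouxOps R) :
    ∃ b : Module.Basis (Fin n) Rᵐᵒᵖ (LinearMap.ker P),
      IsUnit (wronskiMatrix fun j => (b j : RMero R)) := by
  obtain ⟨J, hJ⟩ := exists_jet_bijective hn hP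
  let opEquiv : R ≃ₗ[Rᵐᵒᵖ] Rᵐᵒᵖ :=
    { MulOpposite.opAddEquiv with map_smul' := fun _ _ => rfl }
  let b : Module.Basis (Fin n) Rᵐᵒᵖ (LinearMap.ker P) :=
    Module.Basis.ofEquivFun ((LinearEquiv.ofBijective _ hJ).trans
      (LinearEquiv.piCongrRight fun _ => opEquiv))
  exact ⟨b, isUnit_wronskiMatrix_of_span_jet (le_span_range_coe_basis b) (span_jet_ker hn hP)⟩

theorem ker_mem_adelicModules [FiniteDimensional ℂ R] (he : IsPrimitiveSystem e)
    {P : Module.End Rᵐᵒᵖ (RMero R)} (hP : P ∈ darbouxOps R) :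
    LinearMap.ker P ∈ adelicModules e := by
  obtain ⟨n, hn⟩ := hP.1
  obtain ⟨b, hb⟩ := exists_basis_ker hn hP
  have hle := ker_le_quasiPolys hP
  exact ⟨hle, ⟨n, b, hb⟩, (isGradedByExponents_ker hn hle).hasAdelicBasis he ⟨b⟩⟩

theorem injOn_ker [FiniteDimensional ℂ R] :
    Set.InjOn LinearMap.ker (darbouxOps R) := by
  intro P hP P' hP' h
  rcases subsingleton_or_nontrivial R with hR | hR
  · have : Subsingleton (RMero R) := Algebra.TensorProduct.includeLeftRingHom.codomain_trivial
      (α := R)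
    exact LinearMap.ext fun f => Subsingleton.elim _ _
  obtain ⟨n, hn⟩ := hP.1
  obtain ⟨n', hn'⟩ := hP'.1
  obtain rfl : n = n' := Nat.eq_of_mul_eq_mul_right (Module.finrank_pos (R := ℂ) (M := R)) (by
    rw [← finrank_ker hn hP, ← finrank_ker hn' hP', h])
  obtain ⟨b, hb⟩ := exists_basis_ker hn hP
  exact eq_of_isMonicRationalOp hb hn hn' (fun j => (b j).2) fun j => h.le (b j).2

theorem injOn_waveFun : Set.InjOn waveFun (darbouxOps R) := by
  intro P hP P' hP' h
  obtain ⟨n, hn⟩ := hP.1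
  obtain ⟨n', hn'⟩ := hP'.1
  have hmem : ∀ {n} {P : Module.End Rᵐᵒᵖ (RMero R)}, IsMonicRationalOp n P →
      P ∈ opsLT (ratSubring R) (n + 1) := fun {n P} hn => by
    have h1 : mulLeft (1 : RMero R) * RMero.D R ^ n ∈ opsLT (ratSubring R) (n + 1) :=
      monomial_mem_opsLT (ratSubring R).one_mem n.lt_succ_self
    have h2 := add_mem (opsLT_mono n.le_succ (isMonicRationalOp_iff.1 hn)) h1
    rwa [mulLeft_one, one_mul, sub_add_cancel] at h2
  obtain ⟨a, -, ha⟩ := sub_mem (opsLT_mono (le_max_left (n + 1) (n' + 1)) (hmem hn))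
    (opsLT_mono (le_max_right (n + 1) (n' + 1)) (hmem hn'))
  have ha0 : a = 0 := eq_zero_of_diffOp_exp_eq_zero a fun z => by
    rw [← ha, LinearMap.sub_apply, sub_eq_zero]
    exact congrFun h z
  rw [ha0, diffOp_zero] at ha
  exact sub_eq_zero.1 ha

/-- A complement of the kernel consists of the quasipolynomials whose jet vanishes at a suitable
point. -/
theorem exists_complement_ker [FiniteDimensional ℂ R] {P : Module.End Rᵐᵒᵖ (RMero R)}
    (hP : P ∈ darbouxOps R) : ∃ W : Submodule Rᵐᵒᵖ (RMero R),
      Disjoint (LinearMap.ker P) W ∧ LinearMap.ker P ⊔ W = quasiPolys R := by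
  obtain ⟨n, hn⟩ := hP.1
  obtain ⟨J, hJ⟩ := exists_jet_bijective hn hP
  refine ⟨LinearMap.ker J ⊓ quasiPolys R, ?_, ?_⟩
  · rw [Submodule.disjoint_def]
    rintro f hf ⟨hfJ, -⟩
    have h1 : (⟨f, hf⟩ : LinearMap.ker P) = 0 := hJ.1 (by
      rw [map_zero]
      exact hfJ)
    exact congrArg Subtype.val h1
  · refine le_antisymm (sup_le (ker_le_quasiPolys hP) inf_le_right) fun f hf => ?_
    obtain ⟨⟨g, hg⟩, hgf⟩ := hJ.2 (J f)
    have hgf' : J g = J f := hgf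
    refine Submodule.mem_sup.2 ⟨g, hg, f - g, ⟨?_, sub_mem hf (ker_le_quasiPolys hP hg)⟩,
      add_sub_cancel g f⟩
    change J (f - g) = 0
    rw [map_sub, hgf', sub_self]

end

theorem theoremA (R : Type*) [Ring R] [Algebra ℂ R] [FiniteDimensional ℂ R]
    {m : ℕ} (e : Fin m → R) (he : IsPrimitiveSystem e) :
    -- The quasipolynomials are the direct sum of the modules of `p(x) exp (α x)`.
    iSupIndep (expComponent R) ∧
    -- The operators are determined by the functions `P exp (x z)`, and correspond to the modules
    -- through their kernels in the meromorphic functions.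
    Set.BijOn waveFun (darbouxOps R) (decoratedGr R) ∧
    Set.BijOn LinearMap.ker (darbouxOps R) (adelicModules e) ∧
    -- The operator of `V` is the unique monic rational operator of order `rank V` with kernel `V`.
    (∀ V ∈ adelicModules e, ∀ l : ℕ, IsFreeOfRank V l →
      ∃ P ∈ darbouxOps R, (IsMonicRationalOp l P ∧ LinearMap.ker P = V) ∧
        ∀ P', IsMonicRationalOp l P' → LinearMap.ker P' = V → P' = P) ∧
    -- All these modules are direct summands of the quasipolynomials.
    (∀ V ∈ adelicModules e, ∃ W : Submodule Rᵐᵒᵖ (RMero R),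
      Disjoint V W ∧ V ⊔ W = quasiPolys R) ∧
    -- The three adelic type conditions are equivalent.
    (∀ V : Submodule Rᵐᵒᵖ (RMero R), V ≤ quasiPolys R → (∃ l, IsFreeOfRank V l) →
      List.TFAE [HasAdelicBasis e V, HasCyclicDecomposition e V, IsGradedByExponents V]) := by
  have hker : ∀ V ∈ adelicModules e, ∃ P ∈ darbouxOps R, LinearMap.ker P = V := by
    intro V hV
    obtain ⟨l, b, -⟩ := hV.2.1
    obtain ⟨P, hP, -, h⟩ := exists_mem_darbouxOps_ker_eq he hV ⟨b⟩
    exact ⟨P, hP, h⟩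
  refine ⟨iSupIndep_expComponent, ⟨fun P hP => ⟨P, hP, rfl⟩, injOn_waveFun, ?_⟩,
    ⟨fun P hP => ker_mem_adelicModules he hP, injOn_ker, hker⟩, ?_, ?_, ?_⟩
  · rintro _ ⟨P, hP, rfl⟩
    exact ⟨P, hP, rfl⟩
  · intro V hV l hl
    obtain ⟨F, -, -, hFV, -, hW, -⟩ := exists_adelic_family hV hl
    obtain ⟨P, hP, hPl, rfl⟩ := exists_mem_darbouxOps_ker_eq he hV hl
    refine ⟨P, hP, ⟨hPl, rfl⟩, fun P' hP' h => ?_⟩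
    exact eq_of_isMonicRationalOp hW hP' hPl
      (fun j => LinearMap.mem_ker.1 (h.symm ▸ hFV j)) hFV
  · intro V hV
    obtain ⟨P, hP, rfl⟩ := hker V hV
    exact exists_complement_ker hP
  · rintro V - ⟨l, hl⟩
    tfae_have 1 → 2 := HasAdelicBasis.hasCyclicDecomposition he
    tfae_have 2 → 3 := HasCyclicDecomposition.isGradedByExponents
    tfae_have 3 → 1 := fun h => h.hasAdelicBasis he hl
    tfae_finish
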